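/- Let $\Bbbk$ be an algebraically closed field of characteristic zero, let $u\in\Bbbk[h]$ be such that $g(h)=u(h-1)-u(h)\neq 0$, and let $S_u$ be the Smith algebra: the unital associative $\Bbbk$-algebra generated by $x,y,h$ with relations $[h,y]=y$, $[h,x]=-x$, $[y,x]=g(h)$. Let $C\in\Bbbk$, let $R$ be the multiset of roots of $u+C$, and for a submultiset $X\subseteq R$ let $A_C(X)=\Bbbk[h]$ be the $S_u$-module on which $h$ acts by multiplication and $$x f(h)=f(h+1)\,q(h),\qquad y f(h)=f(h-1)\,p(h),\qquad q(h)=\prod_{\alpha\in X}(h-\alpha),\quad p(h)=\frac{u(h-1)+C}{q(h-1)}.$$ Write $\alpha\preccurlyeq\beta$ if $\beta-\alpha\in\mathbb Z_{\ge 0}$, and $\alpha\prec\beta$ if moreover $\alpha\ne\beta$. With cardinalities counted with multiplicities, put $$\varphi_X(\beta)=\min\bigl\{|(R\setminus X)_{\prec\beta}|,\ |X_{\succcurlyeq\beta}|\bigr\},\qquad \ell(X)=\sum_{\beta\in X}|(R\setminus X)_{\prec\beta}|.$$ For $\beta\in X$ with $(R\setminus X)_{\prec\beta}\neq\emptyset$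 let $X\star\beta$ be obtained from $X$ by replacing one copy of $\beta$ by the element of $(R\setminus X)_{\prec\beta}$ nearest to $\beta$. Let $\mathcal L_C(X)$ be the set consisting of $0$ and of all monic $t\in\Bbbk[h]$ such that $t(h)$ divides both $t(h-1)p(h)$ and $t(h+1)q(h)$. An admissible step replaces $X$ by $X\star\beta$, where $\beta$ is the largest root of a nonzero element $t$ that is minimal, for divisibility, in $\mathcal L_C(X)\setminus\{1\}$. For $\lambda\in\Bbbk$ let $V(\lambda)$ be the Verma module of highest weight $\lambda$, that is, the $S_u$-module induced from the one-dimensional module over the subalgebra generated by $h$ and $y$ on which $h$ acts by $\lambda$ and $y$ acts by $0$; let $L(\lambda)$ be the quotient of $V(\lambda)$ by its unique maximal submodule. Let $K_0(S_u)$ be the free abelian group on the isomorphism classes of finitely generated $S_u$-modules modulo the relations $[M]=[M']+[M'']$ for all short exact sequences $0\to M'\to M\to M''\to 0$ of such modules. Then, for every submultiset $X\subseteq R$: 1. There is exactly one submultiset $X^\star\subseteq R$ with $\ell(X^\star)=0$ that can be reached from $X$ by finitely many admissible steps, and $\mathrm{soc}(A_C(X))\simeq A_C(X^\star)$. 2.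 In $K_0(S_u)$, the sum being over the distinct roots $\beta$ of $u+C$, $$[A_C(X)]=[A_C(X^\star)]+\sum_{\beta}\varphi_X(\beta)\,[L(\beta)].$$ 3. $A_C(X)$ has finite length. In every composition series of $A_C(X)$, each factor is isomorphic to $A_C(X^\star)$ or to $L(\beta)$ for some root $\beta$ of $u+C$; the module $A_C(X^\star)$ occurs exactly once; and, for every root $\beta$ of $u+C$, the module $L(\beta)$ occurs exactly $\varphi_X(\beta)$ times. Moreover $L(\beta)$ is finite-dimensional whenever $\varphi_X(\beta)\neq 0$. -/

import Mathlib

open Polynomial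

universe u

/-! ### The Smith algebra -/

/-- Names of the three generators of the Smith algebra. -/
inductive SmithGen : Type
  | x
  | y
  | h

section Algebra

variable {k : Type u} [Field k]

/-- The defining polynomial `g(h) = u(h-1) - u(h)`. -/
noncomputable def smithG (u : k[X]) : k[X] := u.comp (X - 1) - u

/-- The defining relations `[h,y] = y`, `[h,x] = -x`, `[y,x] = g(h)`, with
`g(h) = u(h-1) - u(h)`. -/
inductive SmithRel (u : k[X]) : FreeAlgebra k SmithGen → FreeAlgebra k SmithGen → Prop
  | hy : SmithRel u
      (FreeAlgebra.ι k SmithGen.h * FreeAlgebra.ι k SmithGen.y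
        - FreeAlgebra.ι k SmithGen.y * FreeAlgebra.ι k SmithGen.h)
      (FreeAlgebra.ι k SmithGen.y)
  | hx : SmithRel u
      (FreeAlgebra.ι k SmithGen.h * FreeAlgebra.ι k SmithGen.x
        - FreeAlgebra.ι k SmithGen.x * FreeAlgebra.ι k SmithGen.h)
      (-FreeAlgebra.ι k SmithGen.x)
  | yx : SmithRel u
      (FreeAlgebra.ι k SmithGen.y * FreeAlgebra.ι k SmithGen.x
        - FreeAlgebra.ι k SmithGen.x * FreeAlgebra.ι k SmithGen.y)
      (aeval (FreeAlgebra.ι k SmithGen.h) (smithG u))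

/-- The Smith algebra `S_u`. -/
abbrev SmithAlgebra (u : k[X]) : Type u := RingQuot (SmithRel u)

/-- The class of a generator in the Smith algebra. -/
noncomputable def SmithAlgebra.gen (u : k[X]) (a : SmithGen) : SmithAlgebra u :=
  RingQuot.mkAlgHom k (SmithRel u) (FreeAlgebra.ι k a)

/-! ### The modules `A_C(Z)` -/

/-- Submultisets of the multiset of roots of `u + c`. -/
abbrev SubRoots (u : k[X]) (c : k) : Type u := {Z : Multiset k // Z ≤ (u + C c).roots}

/-- The monic polynomial with multiset of roots `Z`. -/
noncomputable def rootPoly (Z : Multiset k) : k[X] := (Z.map fun a => X - C a).prod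

/-- `p(h) = (u(h-1) + c) / q(h-1)`, where `q` is the monic polynomial with multiset of roots `Z`
(an exact division when `Z` is a submultiset of the multiset of roots of `u + c`). -/
noncomputable def smithP (u : k[X]) (c : k) (Z : Multiset k) : k[X] :=
  (u + C c).comp (X - 1) /ₘ (rootPoly Z).comp (X - 1)

theorem rootPoly_monic (Z : Multiset k) : (rootPoly Z).Monic :=
  monic_multiset_prod_of_monic _ _ fun a _ => monic_X_sub_C a

theorem rootPoly_shift_monic (Z : Multiset k) : ((rootPoly Z).comp (X - 1)).Monic := by
  have h : (X - 1 : k[X]) = X - C 1 := by simp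
  rw [h]
  exact (rootPoly_monic Z).comp (monic_X_sub_C 1) (by rw [natDegree_X_sub_C]; exact one_ne_zero)

theorem smithP_mul (u : k[X]) (c : k) (Z : SubRoots u c) :
    (rootPoly Z.1).comp (X - 1) * smithP u c Z.1 = (u + C c).comp (X - 1) := by
  have hd : rootPoly Z.1 ∣ u + C c :=
    (Multiset.prod_dvd_prod_of_le (Multiset.map_le_map Z.2)).trans
      (prod_multiset_X_sub_C_dvd (u + C c))
  have hd' : (rootPoly Z.1).comp (X - 1) ∣ (u + C c).comp (X - 1) := by
    obtain ⟨r, hr⟩ := hd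
    exact ⟨r.comp (X - 1), by rw [← mul_comp, ← hr]⟩
  have h0 := (modByMonic_eq_zero_iff_dvd (rootPoly_shift_monic Z.1)).2 hd'
  have h1 := modByMonic_add_div ((u + C c).comp (X - 1)) ((rootPoly Z.1).comp (X - 1))
  rw [h0, zero_add] at h1
  exact h1

/-- The `k`-linear operator `f(h) ↦ f(h + a) r(h)`. -/
noncomputable def shiftMul (a : k) (r : k[X]) : Module.End k k[X] where
  toFun f := f.comp (X + C a) * r
  map_add' f g := by rw [add_comp, add_mul]
  map_smul' b f := by rw [smul_comp, smul_mul_assoc, RingHom.id_apply]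

/-- The operators by which the generators act on `A_c(Z)`:
`x f(h) = f(h+1) q(h)`, `y f(h) = f(h-1) p(h)`, and `h` acts by multiplication. -/
noncomputable def smithOp (u : k[X]) (c : k) (Z : Multiset k) : SmithGen → Module.End k k[X]
  | SmithGen.x => shiftMul 1 (rootPoly Z)
  | SmithGen.y => shiftMul (-1) (smithP u c Z)
  | SmithGen.h => shiftMul 0 X

theorem aeval_smithOp_h (u : k[X]) (c : k) (Z : Multiset k) (r f : k[X]) :
    aeval (smithOp u c Z SmithGen.h) r f = r * f := by
  induction r using Polynomial.induction_on' with
  | add r s hr hs => rw [map_add, LinearMap.add_apply, hr, hs, add_mul]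
  | monomial n a =>
    have hn : ∀ n : ℕ, (smithOp u c Z SmithGen.h ^ n) f = X ^ n * f := by
      intro n
      induction n with
      | zero => simp
      | succ n ih =>
        rw [pow_succ', Module.End.mul_apply, ih]
        simp only [smithOp, shiftMul, LinearMap.coe_mk, AddHom.coe_mk, C_0, add_zero, comp_X]
        ring
    rw [aeval_monomial, Module.End.mul_apply, hn, Module.algebraMap_end_apply,
      ← C_mul_X_pow_eq_monomial, mul_assoc, smul_eq_C_mul]

theorem smithOp_rel (u : k[X]) (c : k) (Z : SubRoots u c) ⦃a b : FreeAlgebra k SmithGen⦄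
    (hab : SmithRel u a b) :
    FreeAlgebra.lift k (smithOp u c Z.1) a = FreeAlgebra.lift k (smithOp u c Z.1) b := by
  cases hab with
  | hy =>
    simp only [map_sub, map_mul, FreeAlgebra.lift_ι_apply]
    refine LinearMap.ext fun f => ?_
    simp only [smithOp, shiftMul, LinearMap.sub_apply, Module.End.mul_apply, LinearMap.coe_mk,
      AddHom.coe_mk, C_0, add_zero, comp_X, mul_comp, X_comp, C_neg, C_1]
    ring
  | hx =>
    simp only [map_sub, map_neg, map_mul, FreeAlgebra.lift_ι_apply]
    refine LinearMap.ext fun f => ?_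
    simp only [smithOp, shiftMul, LinearMap.sub_apply, LinearMap.neg_apply, Module.End.mul_apply,
      LinearMap.coe_mk, AddHom.coe_mk, C_0, add_zero, comp_X, mul_comp, X_comp, C_1]
    ring
  | yx =>
    rw [← aeval_algHom_apply]
    simp only [map_sub, map_mul, FreeAlgebra.lift_ι_apply]
    refine LinearMap.ext fun f => ?_
    rw [aeval_smithOp_h]
    have h1 := smithP_mul u c Z
    have h2 : rootPoly Z.1 * (smithP u c Z.1).comp (X + 1) = u + C c := by
      have h3 := congrArg (fun r : k[X] => r.comp (X + 1)) h1
      simpa [mul_comp, comp_assoc] using h3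
    simp only [smithOp, shiftMul, LinearMap.sub_apply, Module.End.mul_apply, LinearMap.coe_mk,
      AddHom.coe_mk, mul_comp, comp_assoc, add_comp, X_comp, C_comp, C_neg, C_1, one_comp,
      ← sub_eq_add_neg, smithG] at h1 h2 ⊢
    simp only [sub_add_cancel, one_comp, sub_comp, X_comp, comp_X,
      add_sub_cancel_right] at h1 h2 ⊢
    linear_combination f * h1 - f * h2

/-- The representation of `S_u` on `k[h]` defining `A_c(Z)`. -/
noncomputable def smithRep (u : k[X]) (c : k) (Z : SubRoots u c) :
    SmithAlgebra u →ₐ[k] Module.End k k[X] :=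
  RingQuot.liftAlgHom k ⟨FreeAlgebra.lift k (smithOp u c Z.1), smithOp_rel u c Z⟩

theorem smithRep_gen (u : k[X]) (c : k) (Z : SubRoots u c) (a : SmithGen) :
    smithRep u c Z (SmithAlgebra.gen u a) = smithOp u c Z.1 a := by
  rw [smithRep, SmithAlgebra.gen, RingQuot.liftAlgHom_mkAlgHom_apply, FreeAlgebra.lift_ι_apply]

/-- The `S_u`-module `A_c(Z)`, with underlying space `k[h]`. -/
def SmithA (u : k[X]) (c : k) (_Z : SubRoots u c) : Type u := k[X]

noncomputable instance (u : k[X]) (c : k) (Z : SubRoots u c) : AddCommGroup (SmithA u c Z) :=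
  inferInstanceAs (AddCommGroup k[X])

noncomputable instance (u : k[X]) (c : k) (Z : SubRoots u c) :
    Module (SmithAlgebra u) (SmithA u c Z) :=
  Module.compHom k[X] (smithRep u c Z).toRingHom

theorem SmithA.smul_def (u : k[X]) (c : k) (Z : SubRoots u c) (s : SmithAlgebra u) (f : k[X]) :
    (s • (show SmithA u c Z from f) : SmithA u c Z) = smithRep u c Z s f := rfl

/-- `A_c(Z)` is finitely generated over `S_u` (by the polynomial `1`). -/
instance (u : k[X]) (c : k) (Z : SubRoots u c) :
    Module.Finite (SmithAlgebra u) (SmithA u c Z) := by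
  refine ⟨⟨{(show SmithA u c Z from (1 : k[X]))}, ?_⟩⟩
  rw [Finset.coe_singleton, Submodule.span_singleton_eq_top_iff]
  intro f
  refine ⟨aeval (SmithAlgebra.gen u SmithGen.h) (show k[X] from f), ?_⟩
  rw [SmithA.smul_def, ← aeval_algHom_apply, smithRep_gen, aeval_smithOp_h, mul_one]

/-! ### Verma modules and their simple quotients -/

/-- The Verma module `V(l)` of highest weight `l`: the `S_u`-module induced from the
one-dimensional module over the subalgebra generated by `h` and `y` on which `h` acts by `l` and
`y` acts by `0`.  It is presented as the quotient of `S_u` by the left ideal generated by `y` and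
`h - l`. -/
abbrev SmithVerma (u : k[X]) (l : k) : Type u :=
  SmithAlgebra u ⧸ (Submodule.span (SmithAlgebra u)
    {SmithAlgebra.gen u SmithGen.y,
      SmithAlgebra.gen u SmithGen.h - algebraMap k (SmithAlgebra u) l} :
    Submodule (SmithAlgebra u) (SmithAlgebra u))

/-- The sum of all proper submodules of `V(l)`, i.e. its unique maximal submodule. -/
def SmithVerma.maxSubmodule (u : k[X]) (l : k) :
    Submodule (SmithAlgebra u) (SmithVerma u l) :=
  sSup {N | N ≠ ⊤}

/-- `L(l)`, the quotient of the Verma module `V(l)` by its unique maximal submodule. -/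
abbrev SmithL (u : k[X]) (l : k) : Type u :=
  SmithVerma u l ⧸ SmithVerma.maxSubmodule u l

/-! ### The order on `k` and the combinatorics of submultisets of roots -/

/-- `a ≼ b` if and only if `b - a` is a natural number. -/
def SmithLE (a b : k) : Prop := ∃ n : ℕ, b - a = n

/-- `a ≺ b`. -/
def SmithLT (a b : k) : Prop := SmithLE a b ∧ a ≠ b

open Classical in
/-- The complement of `Z` in the multiset of roots of `u + c`. -/
noncomputable def rootCompl (u : k[X]) (c : k) (Z : SubRoots u c) : Multiset k :=
  (u + C c).roots - Z.1

open Classical in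
/-- The underlying set of the multiset of roots of `u + c`. -/
noncomputable def distinctRoots (u : k[X]) (c : k) : Finset k := (u + C c).roots.toFinset

open Classical in
/-- The number (with multiplicities) of elements of `Z` that are `≺ b`. -/
noncomputable def cardBelow (Z : Multiset k) (b : k) : ℕ :=
  (Z.filter fun a => SmithLT a b).card

open Classical in
/-- The number (with multiplicities) of elements of `Z` that are `≽ b`. -/
noncomputable def cardAbove (Z : Multiset k) (b : k) : ℕ :=
  (Z.filter fun a => SmithLE b a).card

/-- `φ_Z(b) = min {|(R ∖ Z)_{≺ b}|, |Z_{≽ b}|}`, with `R` the multiset of roots of `u + c`. -/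
noncomputable def smithPhi (u : k[X]) (c : k) (Z : SubRoots u c) (b : k) : ℕ :=
  min (cardBelow (rootCompl u c Z) b) (cardAbove Z.1 b)

/-- `ℓ(Z) = ∑_{b ∈ Z} |(R ∖ Z)_{≺ b}|`, the sum being taken with multiplicities. -/
noncomputable def smithEll (u : k[X]) (c : k) (Z : SubRoots u c) : ℕ :=
  (Z.1.map fun b => cardBelow (rootCompl u c Z) b).sum

/-- The set of generators of the submodules of `A_c(Z)`: the monic `t` such that
`t(h)` divides `t(h-1) p(h)` and `t(h+1) q(h)`, together with `0`. -/
def smithLattice (u : k[X]) (c : k) (Z : SubRoots u c) : Set k[X] :=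
  {t | t.Monic ∧ t ∣ t.comp (X - 1) * smithP u c Z.1 ∧ t ∣ t.comp (X + 1) * rootPoly Z.1} ∪ {0}

/-- `t` is a minimal element, for divisibility, of `smithLattice u c Z ∖ {1}`. -/
def IsMinimalGenerator (u : k[X]) (c : k) (Z : SubRoots u c) (t : k[X]) : Prop :=
  t ∈ smithLattice u c Z \ {1} ∧ ∀ s ∈ smithLattice u c Z \ {1}, s ∣ t → s = t

open Classical in
/-- `Z'` equals `Z ⋆ b`: it is obtained from `Z` by replacing one copy of `b ∈ Z` by the element
`b'` of `(R ∖ Z)_{≺ b}` that is nearest to `b`. -/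
def IsStar (u : k[X]) (c : k) (Z : SubRoots u c) (b : k) (Z' : SubRoots u c) : Prop :=
  b ∈ Z.1 ∧ ∃ b' ∈ rootCompl u c Z, SmithLT b' b ∧
    (∀ a ∈ rootCompl u c Z, SmithLT a b → SmithLE a b') ∧
    Z'.1 = b' ::ₘ Z.1.erase b

/-- One step of the iteration: `Z' = Z ⋆ b` where `b` is the largest root of a nonzero minimal
element `t` of `smithLattice u c Z ∖ {1}`. -/
def StarStep (u : k[X]) (c : k) (Z Z' : SubRoots u c) : Prop :=
  ∃ t : k[X], ∃ b : k, IsMinimalGenerator u c Z t ∧ t ≠ 0 ∧ b ∈ t.roots ∧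
    (∀ a ∈ t.roots, SmithLE a b) ∧ IsStar u c Z b Z'

/-- `Z'` is an end point `Z^⋆` of the iteration started at `Z`: it is reached from `Z` by finitely
many steps, and `ℓ(Z') = 0`. -/
def IsStarEnd (u : k[X]) (c : k) (Z Z' : SubRoots u c) : Prop :=
  Relation.ReflTransGen (StarStep u c) Z Z' ∧ smithEll u c Z' = 0

end Algebra

/-! ### Socle, composition factors, Grothendieck group -/

section Modules

variable (S : Type u) [Ring S]

/-- The socle of a module: the sum of its simple submodules. -/
def moduleSocle (M : Type u) [AddCommGroup M] [Module S M] : Submodule S M :=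
  sSup {N | IsSimpleModule S N}

variable {S} in
/-- The `i`-th factor of a composition series. -/
abbrev seriesFactor {M : Type u} [AddCommGroup M] [Module S M]
    (s : CompositionSeries (Submodule S M)) (i : Fin s.length) : Type u :=
  (s i.succ : Submodule S M) ⧸ (s i.castSucc).submoduleOf (s i.succ)

variable {S} in
/-- The number of factors of a composition series that are isomorphic to `N`. -/
noncomputable def factorCount {M : Type u} [AddCommGroup M] [Module S M]
    (s : CompositionSeries (Submodule S M)) (N : Type u) [AddCommGroup N] [Module S N] : ℕ :=
  Nat.card {i : Fin s.length // Nonempty (seriesFactor s i ≃ₗ[S] N)}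

/-- Isomorphism of finitely generated modules. -/
def fgModuleSetoid : Setoid (FGModuleCat.{u} S) where
  r M N := Nonempty (M ≃ₗ[S] N)
  iseqv :=
    { refl := fun M => ⟨LinearEquiv.refl S M⟩
      symm := fun ⟨e⟩ => ⟨e.symm⟩
      trans := fun ⟨e⟩ ⟨f⟩ => ⟨e.trans f⟩ }

/-- Isomorphism classes of finitely generated (left) modules. -/
abbrev FGModuleIsoClass : Type (u + 1) := Quotient (fgModuleSetoid S)

/-- The isomorphism class of a module, as an element of the free abelian group on isomorphism
classes. -/
def isoClass (M : FGModuleCat.{u} S) : FreeAbelianGroup (FGModuleIsoClass S) :=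
  FreeAbelianGroup.of (Quotient.mk (fgModuleSetoid S) M)

/-- The subgroup generated by `[M] - [M'] - [M'']` for all short exact sequences
`0 → M' → M → M'' → 0` of finitely generated modules. -/
def exactRelations : AddSubgroup (FreeAbelianGroup (FGModuleIsoClass S)) :=
  AddSubgroup.closure {z | ∃ (M' M M'' : FGModuleCat.{u} S) (f : M' →ₗ[S] M) (g : M →ₗ[S] M''),
    Function.Injective f ∧ Function.Exact f g ∧ Function.Surjective g ∧
      z = isoClass S M - isoClass S M' - isoClass S M''}

/-- The Grothendieck group `K_0(S)` of the category of finitely generated `S`-modules. -/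
abbrev SmithK0 : Type (u + 1) := FreeAbelianGroup (FGModuleIsoClass S) ⧸ exactRelations S

/-- The class `[M]` of a finitely generated module in `K_0(S)`. -/
def K0Class (M : Type u) [AddCommGroup M] [Module S M] [Module.Finite S M] : SmithK0 S :=
  QuotientAddGroup.mk (isoClass S (FGModuleCat.of S M))

end Modules

/-! Since `h` acts by multiplication, a submodule of A_C(X) is an ideal of k[h]. Stability under `y`
and `x` amounts to the two divisibilities defining L_C(X) (`SmithA.exists_generator`). Evaluated at
a root `a` of a nonzero generator `t`, they say that `a - 1` is a root unless it lies in R∖X, and `a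
+ 1` is a root unless `a` lies in X. As `t` has finitely many roots, every root has a root in X at
or above it and an element of R∖X strictly below it. So A_C(X) is simple if ℓ(X) = 0. If ℓ(X) ≠ 0,
elements `b` of X and `b - n` of R∖X at the least positive distance give a minimal generator, the
product `t` of the `h - (b - i)` for i < n.

For such `t` one has q_{X⋆b}/q_X = (h - (b - n))/(h - b) = t(h+1)/t(h), so multiplication by `t`
embeds A_C(X⋆b) into A_C(X) (`SmithA.starHom`). Minimality of `t` makes the image a maximal
submodule. The quotient k[h]/(t) is simple of dimension n, and t/(h - b) is a highest weight vector
in it, so it is L(b) (`IsAdjacent.nonempty_quotient_equiv`). The step lowers φ by one on ]b - n, b],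
an interval whose only root of u + C is `b` (`IsAdjacent.smithPhi_eq`). Thus each step splits off
one L(b) and takes one from φ(b), and induction along the steps gives the class in K_0 and a
composition series.

Uniqueness of the end point comes from an invariant: |X_{≽a}| - φ_X(a) is preserved by every step,
for every `a` in k. At the end φ vanishes, so the counts |X^⋆_{≽a}|, hence X^⋆, are determined by X
(`IsStarEnd.cardAbove_eq`). The socle is A_C(X^⋆) because two nonzero ideals of k[h] always meet.
Multiplicities are exact since highest weights separate the simple L(b) and A_C(X^⋆) has no
eigenvector of `h`. Jordan–Hölder carries them to all series. -/

/-! ### Composition series and their factors -/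

section CompositionSeries

variable {S : Type u} [Ring S] {M M' : Type u} [AddCommGroup M] [Module S M]
  [AddCommGroup M'] [Module S M']

/-- The number of factors isomorphic to a given module does not depend on the composition
series. -/
theorem factorCount_eq_of_equivalent {s t : CompositionSeries (Submodule S M)}
    (h : CompositionSeries.Equivalent s t) (N : Type u) [AddCommGroup N] [Module S N] :
    factorCount s N = factorCount t N := by
  obtain ⟨f, hf⟩ := h
  refine Nat.card_congr (f.subtypeEquiv fun i => ?_)
  have e : seriesFactor s i ≃ₗ[S] seriesFactor t (f i) :=
    JordanHolderLattice.Iso.linearEquiv (hf i)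
  exact ⟨fun ⟨g⟩ => ⟨e.symm.trans g⟩, fun ⟨g⟩ => ⟨e.trans g⟩⟩

/-- The length-one composition series of a simple module. -/
theorem exists_compositionSeries_of_isSimpleModule [IsSimpleModule S M] :
    ∃ s : CompositionSeries (Submodule S M), s.head = ⊥ ∧ s.last = ⊤ ∧ s.length = 1 ∧
      ∀ i, Nonempty (seriesFactor s i ≃ₗ[S] M) := by
  have hcov : (⊥ : Submodule S M) ⋖ ⊤ := bot_covBy_top
  refine ⟨(RelSeries.singleton _ (⊥ : Submodule S M)).snoc ⊤ hcov,
    (RelSeries.head_snoc _ _ _).trans rfl, RelSeries.last_snoc _ _ _, rfl, ?_⟩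
  intro i
  obtain rfl : i = Fin.last 0 := Subsingleton.elim (α := Fin 1) _ _
  change Nonempty (((⊤ : Submodule S M) ⧸ (⊥ : Submodule S M).submoduleOf ⊤) ≃ₗ[S] M)
  refine ⟨(Submodule.quotEquivOfEqBot _ ?_).trans Submodule.topEquiv⟩
  rw [Submodule.submoduleOf, Submodule.comap_bot, Submodule.ker_subtype]

/-- A composition series of a submodule with simple quotient extends to the whole module. -/
theorem exists_compositionSeries_extend (φ : M' →ₗ[S] M) (hφ : Function.Injective φ)
    (hc : IsCoatom (LinearMap.range φ)) (s : CompositionSeries (Submodule S M'))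
    (h0 : s.head = ⊥) (h1 : s.last = ⊤) :
    ∃ (t : CompositionSeries (Submodule S M)) (e : Fin t.length ≃ Option (Fin s.length)),
      t.head = ⊥ ∧ t.last = ⊤ ∧
      (∀ i j, e i = some j → Nonempty (seriesFactor t i ≃ₗ[S] seriesFactor s j)) ∧
      (∀ i, e i = none → Nonempty (seriesFactor t i ≃ₗ[S] M ⧸ LinearMap.range φ)) := by
  let s' : CompositionSeries (Submodule S M) :=
    s.map ⟨Submodule.map φ, fun h => Submodule.map_covBy_of_injective hφ h⟩
  have hlast : s'.last = LinearMap.range φ := by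
    change Submodule.map φ s.last = _
    rw [h1, Submodule.map_top]
  have hcov : s'.last ⋖ ⊤ := by rw [hlast]; exact hc.covBy_top
  -- The old factors correspond to `some j`, the new top factor to `none`.
  refine ⟨s'.snoc ⊤ hcov, finSuccEquivLast (n := s.length), ?_, by simp, ?_, ?_⟩
  · rw [RelSeries.head_snoc]
    change Submodule.map φ s.head = _
    rw [h0, Submodule.map_bot]
  · intro i j hij
    obtain rfl : i = Fin.castSucc j := by
      rw [← finSuccEquivLast_symm_some, ← hij]; exact (Equiv.symm_apply_apply _ _).symm
    have ha : (s'.snoc ⊤ hcov) (Fin.castSucc (Fin.castSucc j)) = (s j.castSucc).map φ :=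
      RelSeries.snoc_castSucc s' ⊤ hcov (Fin.castSucc j)
    have hb : (s'.snoc ⊤ hcov) (Fin.succ (Fin.castSucc j)) = (s j.succ).map φ :=
      RelSeries.snoc_castSucc s' ⊤ hcov (Fin.succ j)
    change Nonempty (((s'.snoc ⊤ hcov) (Fin.succ (Fin.castSucc j)) ⧸
      ((s'.snoc ⊤ hcov) (Fin.castSucc (Fin.castSucc j))).submoduleOf
        ((s'.snoc ⊤ hcov) (Fin.succ (Fin.castSucc j)))) ≃ₗ[S] _)
    rw [ha, hb]
    refine ⟨(Submodule.Quotient.equiv _ _ ((s j.succ).equivMapOfInjective φ hφ) ?_).symm⟩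
    ext ⟨x, hx⟩
    obtain ⟨y, hy, rfl⟩ := hx
    simp only [Submodule.submoduleOf, Submodule.mem_map, Submodule.mem_comap,
      Submodule.subtype_apply]
    constructor
    · rintro ⟨z, hz, hzy⟩
      refine ⟨z, hz, ?_⟩
      exact congrArg Subtype.val hzy
    · rintro ⟨z, hz, hzy⟩
      obtain rfl := hφ hzy
      exact ⟨⟨z, hy⟩, hz, rfl⟩
  · intro i hi
    obtain rfl : i = Fin.last s.length := by
      rw [← finSuccEquivLast_symm_none, ← hi]; exact (Equiv.symm_apply_apply _ _).symm
    have ha : (s'.snoc ⊤ hcov) (Fin.castSucc (Fin.last s.length)) = LinearMap.range φ :=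
      (RelSeries.snoc_castSucc s' ⊤ hcov (Fin.last s.length)).trans hlast
    have hb : (s'.snoc ⊤ hcov) (Fin.succ (Fin.last s.length)) = ⊤ :=
      RelSeries.last_snoc' s' ⊤ hcov
    change Nonempty (((s'.snoc ⊤ hcov) (Fin.succ (Fin.last s.length)) ⧸
      ((s'.snoc ⊤ hcov) (Fin.castSucc (Fin.last s.length))).submoduleOf
        ((s'.snoc ⊤ hcov) (Fin.succ (Fin.last s.length)))) ≃ₗ[S] _)
    rw [ha, hb]
    refine ⟨Submodule.Quotient.equiv _ _ Submodule.topEquiv ?_⟩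
    ext x
    simp [Submodule.submoduleOf]

open Classical in
/-- The number of factors isomorphic to a given module is additive along extensions. -/
theorem factorCount_extend {s : CompositionSeries (Submodule S M')}
    {t : CompositionSeries (Submodule S M)} (e : Fin t.length ≃ Option (Fin s.length))
    {Q : Type u} [AddCommGroup Q] [Module S Q]
    (hsome : ∀ i j, e i = some j → Nonempty (seriesFactor t i ≃ₗ[S] seriesFactor s j))
    (hnone : ∀ i, e i = none → Nonempty (seriesFactor t i ≃ₗ[S] Q))
    (N : Type u) [AddCommGroup N] [Module S N] :
    factorCount t N = factorCount s N + if Nonempty (Q ≃ₗ[S] N) then 1 else 0 := by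
  have h : ∀ i, (Nonempty (seriesFactor t i ≃ₗ[S] N)) ↔
      (Option.elim (e i) (Nonempty (Q ≃ₗ[S] N))
        fun j => Nonempty (seriesFactor s j ≃ₗ[S] N)) := by
    intro i
    rcases hi : e i with _ | j
    · obtain ⟨g⟩ := hnone i hi
      exact ⟨fun ⟨f⟩ => ⟨g.symm.trans f⟩, fun ⟨f⟩ => ⟨g.trans f⟩⟩
    · obtain ⟨g⟩ := hsome i j hi
      exact ⟨fun ⟨f⟩ => ⟨g.symm.trans f⟩, fun ⟨f⟩ => ⟨g.trans f⟩⟩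
  have h2 : factorCount t N = Nat.card {o : Option (Fin s.length) //
      Option.elim o (Nonempty (Q ≃ₗ[S] N)) fun j => Nonempty (seriesFactor s j ≃ₗ[S] N)} :=
    Nat.card_congr (e.subtypeEquiv h)
  rw [h2, factorCount, Nat.card_eq_fintype_card, Nat.card_eq_fintype_card, Fintype.card_subtype,
    Fintype.card_subtype, Finset.card_filter, Finset.card_filter, Fintype.sum_option, add_comm]
  rfl

end CompositionSeries

/-! ### The order on the field and the functions φ and ℓ -/

section Combinatorics

variable {k : Type u} [Field k]

theorem SmithLE.refl (a : k) : SmithLE a a := ⟨0, by simp⟩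

theorem SmithLE.trans {a b d : k} (h₁ : SmithLE a b) (h₂ : SmithLE b d) : SmithLE a d := by
  obtain ⟨m, hm⟩ := h₁
  obtain ⟨n, hn⟩ := h₂
  exact ⟨m + n, by push_cast; linear_combination hm + hn⟩

theorem SmithLE.antisymm [CharZero k] {a b : k} (h₁ : SmithLE a b) (h₂ : SmithLE b a) : a = b := by
  obtain ⟨m, hm⟩ := h₁
  obtain ⟨n, hn⟩ := h₂
  have h : ((m + n : ℕ) : k) = 0 := by push_cast; linear_combination -hm - hn
  have hm0 : m = 0 := by have := Nat.cast_eq_zero.1 h; omega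
  rw [hm0, Nat.cast_zero, sub_eq_zero] at hm
  exact hm.symm

theorem smithLE_iff {a b : k} : SmithLE a b ↔ ∃ n : ℕ, a = b - n :=
  exists_congr fun n => ⟨fun h => by rw [← h]; ring, fun h => by rw [h]; ring⟩

theorem smithLT_iff [CharZero k] {a b : k} : SmithLT a b ↔ ∃ n : ℕ, 0 < n ∧ a = b - n := by
  rw [SmithLT, smithLE_iff]
  constructor
  · rintro ⟨⟨n, rfl⟩, hne⟩
    exact ⟨n, Nat.pos_of_ne_zero fun h => hne (by simp [h]), rfl⟩
  · rintro ⟨n, hn, rfl⟩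
    exact ⟨⟨n, rfl⟩, fun h => hn.ne' (by simpa using h)⟩

/-- Elements of a chain are comparable. -/
theorem SmithLE.total {a b d : k} (ha : SmithLE a d) (hb : SmithLE b d) :
    SmithLE a b ∨ SmithLE b a := by
  obtain ⟨m, rfl⟩ := smithLE_iff.1 ha
  obtain ⟨n, rfl⟩ := smithLE_iff.1 hb
  rcases le_total m n with h | h
  · right
    exact ⟨n - m, by rw [Nat.cast_sub h]; ring⟩
  · left
    exact ⟨m - n, by rw [Nat.cast_sub h]; ring⟩

theorem SmithLT.trans_le [CharZero k] {a b d : k} (h₁ : SmithLT a b) (h₂ : SmithLE b d) :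
    SmithLT a d :=
  ⟨h₁.1.trans h₂, fun h => h₁.2 (h₁.1.antisymm (h ▸ h₂))⟩

theorem smithLE_iff_eq_or_add_one [CharZero k] {a b : k} :
    SmithLE a b ↔ a = b ∨ SmithLE (a + 1) b := by
  constructor
  · rintro ⟨n, hn⟩
    rcases n with _ | n
    · left; rw [Nat.cast_zero, sub_eq_zero] at hn; exact hn.symm
    · right; exact ⟨n, by push_cast at hn; linear_combination hn⟩
  · rintro (rfl | h)
    · exact SmithLE.refl a
    · exact SmithLE.trans ⟨1, by simp⟩ h

theorem not_smithLE_add_one [CharZero k] (a : k) : ¬ SmithLE (a + 1) a := by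
  intro h
  have := h.antisymm ⟨1, by simp⟩
  simp at this

open Classical in
/-- A multiset is determined by the numbers of its elements above each point. -/
theorem cardAbove_eq_count_add [CharZero k] (Z : Multiset k) (b : k) :
    cardAbove Z b = Z.count b + cardAbove Z (b + 1) := by
  induction Z using Multiset.induction_on with
  | empty => simp [cardAbove]
  | cons a Z ih =>
    simp only [cardAbove, Multiset.filter_cons, Multiset.card_add, Multiset.count_cons] at ih ⊢
    rw [ih]
    by_cases h1 : b = a
    · subst h1
      simp [SmithLE.refl, not_smithLE_add_one]
      ring
    · by_cases h2 : SmithLE (b + 1) a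
      · have h3 : SmithLE b a := smithLE_iff_eq_or_add_one.2 (Or.inr h2)
        simp [h1, h2, h3]
        ring
      · have h3 : ¬ SmithLE b a := fun h => by
          rcases smithLE_iff_eq_or_add_one.1 h with h | h
          · exact h1 h
          · exact h2 h
        simp [h1, h2, h3]

/-- The multiplicity of `b` is the difference of the counts at `b` and `b + 1`. This turns equality
of end points into equality of counts. -/
theorem ext_of_cardAbove [CharZero k] {Z Z' : Multiset k}
    (h : ∀ b, cardAbove Z b = cardAbove Z' b) : Z = Z' := by
  classical
  refine Multiset.ext.2 fun b => ?_
  have h1 := cardAbove_eq_count_add Z b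
  have h2 := cardAbove_eq_count_add Z' b
  have h3 := h b
  have h4 := h (b + 1)
  convert! (show Multiset.count b Z = Multiset.count b Z' by omega) using 1

variable {u : k[X]} {c : k}

theorem add_rootCompl (Z : SubRoots u c) : Z.1 + rootCompl u c Z = (u + C c).roots := by
  classical
  rw [rootCompl, add_comm]
  exact tsub_add_cancel_of_le Z.2

theorem mem_roots_iff_mem_or (Z : SubRoots u c) {b : k} :
    b ∈ (u + C c).roots ↔ b ∈ Z.1 ∨ b ∈ rootCompl u c Z := by
  have h := congrArg (b ∈ ·) (add_rootCompl Z)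
  simp only [Multiset.mem_add] at h
  exact Iff.of_eq h.symm

theorem mem_distinctRoots (b : k) : b ∈ distinctRoots u c ↔ b ∈ (u + C c).roots := by
  classical
  rw [distinctRoots, Multiset.mem_toFinset]

open Classical in
/-- The submultiset obtained by moving `b ∈ Z` down to `b' ∉ Z` (with multiplicities). -/
noncomputable def starAt (Z : SubRoots u c) (b b' : k) (hb : b ∈ Z.1)
    (hb' : b' ∈ rootCompl u c Z) : SubRoots u c :=
  ⟨b' ::ₘ Z.1.erase b, by
    refine le_of_le_of_eq ?_ (add_rootCompl Z)
    obtain ⟨Y, hY⟩ := Multiset.exists_cons_of_mem hb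
    obtain ⟨W, hW⟩ := Multiset.exists_cons_of_mem hb'
    rw [hW, hY, Multiset.erase_cons_head, Multiset.cons_add, Multiset.add_cons]
    exact (Multiset.cons_le_cons b' (Multiset.le_add_right Y W)).trans (Multiset.le_cons_self _ b)⟩

-- Adding an element to both sides, here and in `cons_starAt`, avoids truncated subtraction, so that
-- the effect of a step on the counts is linear arithmetic.
open Classical in
theorem cons_rootCompl_starAt (Z : SubRoots u c) (b b' : k) (hb : b ∈ Z.1)
    (hb' : b' ∈ rootCompl u c Z) :
    b' ::ₘ rootCompl u c (starAt Z b b' hb hb') = b ::ₘ rootCompl u c Z := by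
  have h1 := (add_rootCompl Z).trans (add_rootCompl (starAt Z b b' hb hb')).symm
  obtain ⟨Y, hY⟩ := Multiset.exists_cons_of_mem hb
  have h2 : (starAt Z b b' hb hb').1 = b' ::ₘ Y := by
    rw [starAt]; simp only [hY, Multiset.erase_cons_head]
  rw [h2, hY, Multiset.cons_add, Multiset.cons_add, ← Multiset.add_cons,
    ← Multiset.add_cons] at h1
  exact (add_left_cancel h1).symm

theorem cons_starAt (Z : SubRoots u c) (b b' : k) (hb : b ∈ Z.1)
    (hb' : b' ∈ rootCompl u c Z) :
    b ::ₘ (starAt Z b b' hb hb').1 = b' ::ₘ Z.1 := by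
  classical
  rw [starAt, Multiset.cons_swap]
  congr 1
  convert! Multiset.cons_erase hb

open Classical in
theorem cardAbove_cons (a : k) (Z : Multiset k) (b : k) :
    cardAbove (a ::ₘ Z) b = cardAbove Z b + if SmithLE b a then 1 else 0 := by
  rw [cardAbove, cardAbove, Multiset.filter_cons, Multiset.card_add, add_comm]
  split_ifs <;> simp

open Classical in
theorem cardBelow_cons (a : k) (Z : Multiset k) (b : k) :
    cardBelow (a ::ₘ Z) b = cardBelow Z b + if SmithLT a b then 1 else 0 := by
  rw [cardBelow, cardBelow, Multiset.filter_cons, Multiset.card_add, add_comm]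
  split_ifs <;> simp

open Classical in
/-- Moving `b` down to `b'` lowers `φ` and the number of elements above a point by one on the
interval `]b', b]`, and leaves them unchanged elsewhere. -/
theorem smithPhi_starAt [CharZero k] (Z : SubRoots u c) {b b' : k} (hb : b ∈ Z.1)
    (hb' : b' ∈ rootCompl u c Z) (hlt : SmithLT b' b) (a : k) :
    smithPhi u c Z a = smithPhi u c (starAt Z b b' hb hb') a +
        (if SmithLT b' a ∧ SmithLE a b then 1 else 0) ∧
      cardAbove Z.1 a = cardAbove (starAt Z b b' hb hb').1 a +
        (if SmithLT b' a ∧ SmithLE a b then 1 else 0) := by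
  have hA := congrArg (fun Y => cardAbove Y a) (cons_starAt Z b b' hb hb')
  have hB := congrArg (fun Y => cardBelow Y a) (cons_rootCompl_starAt Z b b' hb hb')
  simp only [cardAbove_cons, cardBelow_cons] at hA hB
  simp only [smithPhi]
  by_cases h1 : SmithLT b' a
  · have h2 : ¬ SmithLE a b' := fun h => h1.2 (h1.1.antisymm h)
    by_cases h3 : SmithLE a b
    · have h4 : ¬ SmithLT b a := fun h => h.2 (h.1.antisymm h3)
      simp only [h1, h2, h3, h4, and_self, if_true, if_false] at hA hB ⊢
      omega
    -- Both `a` and `b` lie above `b'`, so they are comparable and `a` is strictly above `b`. Then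
    -- `b` and `b'` are both below `a` and neither count changes.
    · have h4 : SmithLT b a := by
        obtain ⟨m, hm⟩ := h1.1
        obtain ⟨n, hn⟩ := hlt.1
        have : n < m := by
          by_contra hmn
          exact h3 ⟨n - m, by rw [Nat.cast_sub (not_lt.1 hmn)]; linear_combination hn - hm⟩
        refine ⟨⟨m - n, by rw [Nat.cast_sub this.le]; linear_combination hm - hn⟩, ?_⟩
        rintro rfl
        exact h3 (SmithLE.refl b)
      simp only [h1, h2, h3, h4, and_false, if_true, if_false] at hA hB ⊢
      omega
  · have h4 : ¬ SmithLT b a := fun h => h1 (hlt.trans_le h.1)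
    have h5 : SmithLE a b ↔ SmithLE a b' := by
      refine ⟨fun h => ?_, fun h => h.trans hlt.1⟩
      rcases h.total hlt.1 with h' | h'
      · exact h'
      · by_contra h6
        exact h1 ⟨h', fun h7 => h6 (h7 ▸ SmithLE.refl _)⟩
    simp only [h1, h4, h5, false_and, if_false] at hA hB ⊢
    omega

theorem cardBelow_pos {Z : Multiset k} {b : k} : 0 < cardBelow Z b ↔ ∃ a ∈ Z, SmithLT a b := by
  classical
  rw [cardBelow, Multiset.card_pos_iff_exists_mem]
  simp

theorem cardAbove_pos {Z : Multiset k} {b : k} : 0 < cardAbove Z b ↔ ∃ a ∈ Z, SmithLE b a := by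
  classical
  rw [cardAbove, Multiset.card_pos_iff_exists_mem]
  simp

theorem smithEll_eq_zero_iff (Z : SubRoots u c) :
    smithEll u c Z = 0 ↔ ∀ b ∈ Z.1, ∀ a ∈ rootCompl u c Z, ¬ SmithLT a b := by
  rw [smithEll, Multiset.sum_eq_zero_iff]
  simp only [Multiset.mem_map, forall_exists_index, and_imp, forall_apply_eq_imp_iff₂]
  refine forall₂_congr fun b _ => ?_
  rw [← not_iff_not, ← Ne, ← Nat.pos_iff_ne_zero, cardBelow_pos]
  push Not
  rfl

/-- If φ(b) > 0, some element of the complement lies below `b` and some element of `Z` at or above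
it. Such a pair contributes to ℓ. -/
theorem smithPhi_eq_zero_of_smithEll_eq_zero [CharZero k] {Z : SubRoots u c}
    (h : smithEll u c Z = 0) (b : k) : smithPhi u c Z b = 0 := by
  rw [smithEll_eq_zero_iff] at h
  by_contra h0
  rw [smithPhi] at h0
  obtain ⟨a, ha, hab⟩ := cardBelow_pos.1
    (show 0 < cardBelow (rootCompl u c Z) b by omega)
  obtain ⟨d, hd, hbd⟩ := cardAbove_pos.1 (show 0 < cardAbove Z.1 b by omega)
  exact h d hd a ha (hab.trans_le hbd)

end Combinatorics

/-! ### Generators of submodules and the iteration -/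

section Lattice

variable {k : Type u} [Field k]

/-- The monic polynomial with simple roots `b, b - 1, …, b - (n - 1)`. -/
noncomputable def intervalPoly (b : k) (n : ℕ) : k[X] := ∏ i ∈ Finset.range n, (X - C (b - i))

theorem intervalPoly_monic (b : k) (n : ℕ) : (intervalPoly b n).Monic :=
  monic_prod_of_monic _ _ fun _ _ => monic_X_sub_C _

theorem natDegree_intervalPoly (b : k) (n : ℕ) : (intervalPoly b n).natDegree = n := by
  rw [intervalPoly, natDegree_prod_of_monic _ _ fun _ _ => monic_X_sub_C _]
  simp only [natDegree_X_sub_C, Finset.sum_const, Finset.card_range, smul_eq_mul, mul_one]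

theorem intervalPoly_ne_one (b : k) {n : ℕ} (hn : 0 < n) : intervalPoly b n ≠ 1 := fun h => by
  have := congrArg natDegree h
  rw [natDegree_intervalPoly, natDegree_one] at this
  omega

theorem isRoot_intervalPoly {b a : k} {n : ℕ} :
    (intervalPoly b n).IsRoot a ↔ ∃ i < n, a = b - i := by
  simp only [intervalPoly, IsRoot.def, eval_prod, Finset.prod_eq_zero_iff, Finset.mem_range,
    eval_sub, eval_X, eval_C, sub_eq_zero]

theorem intervalPoly_succ (b : k) (n : ℕ) :
    intervalPoly b (n + 1) = intervalPoly (b - 1) n * (X - C b) := by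
  rw [intervalPoly, Finset.prod_range_succ', intervalPoly, Nat.cast_zero, sub_zero]
  congr 1
  refine Finset.prod_congr rfl fun i _ => ?_
  congr 2
  push_cast
  ring

theorem intervalPoly_comp (b : k) (n : ℕ) :
    (intervalPoly b n).comp (X + 1) = intervalPoly (b - 1) n := by
  rw [intervalPoly, prod_comp, intervalPoly]
  refine Finset.prod_congr rfl fun i _ => ?_
  simp only [sub_comp, X_comp, C_comp, C_sub, C_1]
  ring

/-- The shift moves the roots to `b - 1, …, b - n`: it trades the top root `b` for `b - n` and keeps
all the others. -/
theorem intervalPoly_comp_mul (b : k) (n : ℕ) :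
    (intervalPoly b n).comp (X + 1) * (X - C b) = intervalPoly b n * (X - C (b - n)) := by
  rw [intervalPoly_comp, ← intervalPoly_succ, intervalPoly, Finset.prod_range_succ, intervalPoly]

/-- A polynomial vanishing at the points `b, …, b - (n - 1)` is divisible by `intervalPoly b n`. -/
theorem intervalPoly_dvd [CharZero k] {b : k} {n : ℕ} {t : k[X]}
    (h : ∀ i < n, t.IsRoot (b - i)) : intervalPoly b n ∣ t := by
  refine Finset.prod_dvd_of_coprime ?_ fun i hi => dvd_iff_isRoot.2 (h i (Finset.mem_range.1 hi))
  intro i _ j _ hij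
  refine isCoprime_X_sub_C_of_isUnit_sub (IsUnit.mk0 _ ?_)
  rw [sub_sub_sub_cancel_left, sub_ne_zero]
  exact fun h => hij (Nat.cast_injective h).symm

theorem rootPoly_cons (a : k) (Z : Multiset k) : rootPoly (a ::ₘ Z) = (X - C a) * rootPoly Z := by
  rw [rootPoly, Multiset.map_cons, Multiset.prod_cons, rootPoly]

theorem isRoot_rootPoly {Z : Multiset k} {a : k} : (rootPoly Z).IsRoot a ↔ a ∈ Z := by
  rw [← mem_roots (rootPoly_monic Z).ne_zero, rootPoly, roots_multiset_prod_X_sub_C]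

variable {u : k[X]} {c : k}

/-- With the next lemma, this says that multiplication by `intervalPoly b n` intertwines the actions
of `x` and of `y`. Both sides become equal after multiplication by `X - C b`. -/
theorem rootPoly_starAt_mul (Z : SubRoots u c) {b : k} {n : ℕ} (hb : b ∈ Z.1)
    (hb' : b - n ∈ rootCompl u c Z) :
    rootPoly (starAt Z b (b - n) hb hb').1 * intervalPoly b n =
      (intervalPoly b n).comp (X + 1) * rootPoly Z.1 := by
  have h1 := congrArg rootPoly (cons_starAt Z b (b - n) hb hb')
  rw [rootPoly_cons, rootPoly_cons] at h1
  refine mul_right_cancel₀ (X_sub_C_ne_zero b) ?_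
  linear_combination (intervalPoly b n) * h1 - rootPoly Z.1 * intervalPoly_comp_mul b n

/-- The product q(h-1) p(h) = u(h-1) + c does not depend on the submultiset, so p changes by the
inverse of the factor by which q(h-1) changes. -/
theorem smithP_starAt_mul (Z : SubRoots u c) {b : k} {n : ℕ} (hb : b ∈ Z.1)
    (hb' : b - n ∈ rootCompl u c Z) :
    smithP u c (starAt Z b (b - n) hb hb').1 * intervalPoly b n =
      (intervalPoly b n).comp (X - 1) * smithP u c Z.1 := by
  have h1 := smithP_mul u c Z
  have h2 := smithP_mul u c (starAt Z b (b - n) hb hb')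
  have h3 := congrArg (fun r : k[X] => r.comp (X - 1)) (rootPoly_starAt_mul Z hb hb')
  have h4 : (X + 1 : k[X]).comp (X - 1) = X := by simp
  simp only [mul_comp, comp_assoc, h4, comp_X] at h3
  refine mul_right_cancel₀ (rootPoly_shift_monic Z.1).ne_zero ?_
  linear_combination -smithP u c (starAt Z b (b - n) hb hb').1 * h3 +
    (intervalPoly b n).comp (X - 1) * h2 - (intervalPoly b n).comp (X - 1) * h1

theorem rootPoly_mul_smithP_comp (Z : SubRoots u c) :
    rootPoly Z.1 * (smithP u c Z.1).comp (X + 1) = u + C c := by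
  have h3 := congrArg (fun r : k[X] => r.comp (X + 1)) (smithP_mul u c Z)
  simpa [mul_comp, comp_assoc] using h3

/-- Cancelling the roots of q in q(h) p(h+1) = u + c leaves the complement of `Z` as the roots of
p(h+1). -/
theorem isRoot_smithP_iff (hu : u + C c ≠ 0) (Z : SubRoots u c) {a : k} :
    (smithP u c Z.1).IsRoot a ↔ a - 1 ∈ rootCompl u c Z := by
  have h1 := rootPoly_mul_smithP_comp Z
  have h2 : (u + C c).roots = Z.1 + ((smithP u c Z.1).comp (X + 1)).roots := by
    have h3 := roots_mul (h1.trans_ne hu)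
    rw [rootPoly, roots_multiset_prod_X_sub_C] at h3
    rw [← h3, ← rootPoly, h1]
  have h3 := (add_rootCompl Z).trans h2
  rw [add_left_cancel h3, mem_roots (right_ne_zero_of_mul (h1.trans_ne hu))]
  simp [IsRoot.def, eval_comp]

theorem mem_smithLattice_iff {Z : SubRoots u c} {t : k[X]} (ht : t ≠ 0) :
    t ∈ smithLattice u c Z ↔
      t.Monic ∧ t ∣ t.comp (X - 1) * smithP u c Z.1 ∧ t ∣ t.comp (X + 1) * rootPoly Z.1 := by
  simp [smithLattice, ht]

theorem intervalPoly_mem_smithLattice {Z : SubRoots u c} {b : k} {n : ℕ} (hb : b ∈ Z.1)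
    (hb' : b - n ∈ rootCompl u c Z) : intervalPoly b n ∈ smithLattice u c Z := by
  rw [mem_smithLattice_iff (intervalPoly_monic b n).ne_zero]
  exact ⟨intervalPoly_monic b n, Dvd.intro_left _ (smithP_starAt_mul Z hb hb'),
    Dvd.intro_left _ (rootPoly_starAt_mul Z hb hb')⟩

theorem exists_not_isRoot_of_injective {t : k[X]} (ht : t ≠ 0) {f : ℕ → k}
    (hf : Function.Injective f) : ∃ n, ¬ t.IsRoot (f n) := by
  by_contra! h
  exact ht (eq_zero_of_infinite_isRoot t
    ((Set.infinite_range_of_injective hf).mono (Set.range_subset_iff.2 h)))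

/-- Above each root of a generator there is a root that belongs to `Z`. -/
theorem exists_root_mem_above [CharZero k] {Z : SubRoots u c} {t : k[X]} (ht : t ≠ 0)
    (htL : t ∈ smithLattice u c Z) {a : k} (ha : t.IsRoot a) :
    ∃ b ∈ Z.1, t.IsRoot b ∧ SmithLE a b := by
  rw [mem_smithLattice_iff ht] at htL
  -- Walk up from `a` to the first non-root `a + m`. At the last root before it, t(h+1) does not
  -- vanish, so q must.
  obtain ⟨n, hn⟩ := exists_not_isRoot_of_injective ht (f := fun n : ℕ => a + n)
    fun i j h => by simpa using h
  classical
  let m := Nat.find (⟨n, hn⟩ : ∃ n : ℕ, ¬ t.IsRoot (a + n))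
  have hm : ¬ t.IsRoot (a + m) := Nat.find_spec (⟨n, hn⟩ : ∃ n : ℕ, ¬ t.IsRoot (a + n))
  have hm0 : m ≠ 0 := fun h => hm (by simpa [h] using ha)
  obtain ⟨l, hl⟩ := Nat.exists_eq_succ_of_ne_zero hm0
  have hroot : t.IsRoot (a + l) := by
    have := Nat.find_min (⟨n, hn⟩ : ∃ n : ℕ, ¬ t.IsRoot (a + n)) (show l < m by omega)
    exact not_not.1 this
  refine ⟨a + l, ?_, hroot, ⟨l, by ring⟩⟩
  have h2 := hroot.dvd htL.2.2
  rw [IsRoot.def, eval_mul, mul_eq_zero] at h2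
  rcases h2 with h2 | h2
  · refine absurd ?_ hm
    rw [hl, IsRoot.def]
    simpa [eval_comp, add_assoc] using h2
  · exact isRoot_rootPoly.1 h2

theorem isRoot_sub_one_or [CharZero k] (hu : u + C c ≠ 0) {Z : SubRoots u c} {t : k[X]}
    (ht : t ≠ 0) (htL : t ∈ smithLattice u c Z) {a : k} (ha : t.IsRoot a) :
    t.IsRoot (a - 1) ∨ a - 1 ∈ rootCompl u c Z := by
  rw [mem_smithLattice_iff ht] at htL
  have h2 := ha.dvd htL.2.1
  rw [IsRoot.def, eval_mul, mul_eq_zero] at h2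
  rcases h2 with h2 | h2
  · left
    simpa [eval_comp] using h2
  · right
    exact (isRoot_smithP_iff hu Z).1 h2

/-- Below each root of a generator there is an element of the complement of `Z`. -/
theorem exists_mem_rootCompl_below [CharZero k] (hu : u + C c ≠ 0) {Z : SubRoots u c} {t : k[X]}
    (ht : t ≠ 0) (htL : t ∈ smithLattice u c Z) {a : k} (ha : t.IsRoot a) :
    ∃ b ∈ rootCompl u c Z, SmithLT b a := by
  by_contra! h
  -- Without an obstruction in the complement, the roots would continue downwards forever.
  have hall : ∀ n : ℕ, t.IsRoot (a - n) := by
    intro n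
    induction n with
    | zero => simpa using ha
    | succ n ih =>
      rcases isRoot_sub_one_or hu ht htL ih with h1 | h1
      · rwa [Nat.cast_succ, ← sub_sub]
      · refine absurd (smithLT_iff.2 ⟨n + 1, n.succ_pos, ?_⟩) (h _ h1)
        push_cast
        ring
  obtain ⟨n, hn⟩ := exists_not_isRoot_of_injective ht (f := fun n : ℕ => a - n)
    fun i j h => by simpa using h
  exact hn (hall n)

/-- If `b` is a root of a generator and `b - n` is the nearest element of the complement of `Z`
below `b`, then the whole interval `]b - n, b]` consists of roots. -/
theorem intervalPoly_dvd_of_mem_smithLattice [CharZero k] (hu : u + C c ≠ 0) {Z : SubRoots u c}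
    {t : k[X]} (ht : t ≠ 0) (htL : t ∈ smithLattice u c Z) {b : k} (hb : t.IsRoot b) {n : ℕ}
    (hn : ∀ a ∈ rootCompl u c Z, SmithLT a b → SmithLE a (b - n)) : intervalPoly b n ∣ t := by
  refine intervalPoly_dvd fun i => ?_
  induction i with
  | zero => intro _; simpa using hb
  | succ i ih =>
    intro hi
    rcases isRoot_sub_one_or hu ht htL (ih (by omega)) with h1 | h1
    · rwa [Nat.cast_succ, ← sub_sub]
    -- Since `i + 1 < n`, an element `b - (i + 1)` of the complement would be nearer to `b` than `b
    -- - n`.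
    · exfalso
      have h2 : b - i - 1 = b - ((i + 1 : ℕ) : k) := by push_cast; ring
      rw [h2] at h1
      obtain ⟨m, hm⟩ := hn _ h1 (smithLT_iff.2 ⟨i + 1, i.succ_pos, rfl⟩)
      have h3 : ((n + m : ℕ) : k) = ((i + 1 : ℕ) : k) := by
        push_cast at hm ⊢
        linear_combination -hm
      have := Nat.cast_injective h3
      omega

theorem exists_isRoot_of_monic_ne_one [IsAlgClosed k] {t : k[X]} (ht : t.Monic) (h1 : t ≠ 1) :
    ∃ a, t.IsRoot a :=
  IsAlgClosed.exists_root t fun h => h1 (ht.eq_one_of_isUnit (isUnit_iff_degree_eq_zero.2 h))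

/-- The generators of `A_c(Z)` are trivial as soon as no element of `Z` lies above an element of
its complement. -/
theorem eq_one_of_mem_smithLattice [IsAlgClosed k] [CharZero k] (hu : u + C c ≠ 0)
    {Z : SubRoots u c} (hZ : smithEll u c Z = 0) {t : k[X]} (ht : t ≠ 0)
    (htL : t ∈ smithLattice u c Z) : t = 1 := by
  by_contra h1
  obtain ⟨a, ha⟩ := exists_isRoot_of_monic_ne_one ((mem_smithLattice_iff ht).1 htL).1 h1
  obtain ⟨b, hb, hbr, -⟩ := exists_root_mem_above ht htL ha
  obtain ⟨d, hd, hdb⟩ := exists_mem_rootCompl_below hu ht htL hbr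
  exact (smithEll_eq_zero_iff Z).1 hZ b hb d hd hdb

/-- The data of one step of the iteration: `b ∈ Z` and `b - n ∉ Z` are adjacent roots, and
`intervalPoly b n` is the corresponding minimal generator. -/
structure IsAdjacent (Z : SubRoots u c) (b : k) (n : ℕ) : Prop where
  pos : 0 < n
  mem : b ∈ Z.1
  mem_compl : b - n ∈ rootCompl u c Z
  minimal : IsMinimalGenerator u c Z (intervalPoly b n)
  nearest : ∀ a ∈ rootCompl u c Z, SmithLT a b → SmithLE a (b - n)

/-- For `b'` = `b - n`, the polynomial `intervalPoly b n` is itself a generator and divides the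
minimal `t`, so the two coincide: every admissible step comes from an adjacent pair. -/
theorem StarStep.exists_isAdjacent [CharZero k] (hu : u + C c ≠ 0) {Z Z' : SubRoots u c}
    (h : StarStep u c Z Z') :
    ∃ (b : k) (n : ℕ) (hA : IsAdjacent Z b n), Z' = starAt Z b (b - n) hA.mem hA.mem_compl := by
  obtain ⟨t, b, hmin, ht0, hbt, -, hbZ, b', hb', hlt, hnear, hZ'⟩ := h
  obtain ⟨n, hn, rfl⟩ := smithLT_iff.1 hlt
  have hdvd : intervalPoly b n ∣ t :=
    intervalPoly_dvd_of_mem_smithLattice hu ht0 hmin.1.1 ((mem_roots ht0).1 hbt) hnear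
  have heq : intervalPoly b n = t :=
    hmin.2 _ ⟨intervalPoly_mem_smithLattice hbZ hb', intervalPoly_ne_one b hn⟩ hdvd
  exact ⟨b, n, ⟨hn, hbZ, hb', heq ▸ hmin, hnear⟩, Subtype.ext hZ'⟩

/-- There is no root strictly between adjacent roots. -/
theorem IsAdjacent.eq_of_mem_roots [CharZero k] {Z : SubRoots u c} {b : k} {n : ℕ}
    (hA : IsAdjacent Z b n) {a : k} (ha : a ∈ (u + C c).roots) (h1 : SmithLT (b - n) a)
    (h2 : SmithLE a b) : a = b := by
  by_contra hne
  rcases (mem_roots_iff_mem_or Z).1 ha with haZ | haW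
  · obtain ⟨i, hi, rfl⟩ := smithLT_iff.1 (⟨h2, hne⟩ : SmithLT a b)
    obtain ⟨m, hm, hmn⟩ := smithLT_iff.1 h1
    have hn : i + m = n := by
      have h3 : ((i + m : ℕ) : k) = (n : k) := by push_cast; linear_combination hmn
      exact Nat.cast_injective h3
    -- An element `b - i` of `Z` inside the interval would, with the same lower end, give a proper
    -- divisor that is again a generator.
    have h4 : intervalPoly (b - i) m ∣ intervalPoly b n := by
      refine intervalPoly_dvd fun j hj => isRoot_intervalPoly.2 ⟨i + j, by omega, ?_⟩
      push_cast
      ring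
    have h5 := hA.minimal.2 _ ⟨intervalPoly_mem_smithLattice haZ (hmn ▸ hA.mem_compl),
      intervalPoly_ne_one _ hm⟩ h4
    have h6 := congrArg natDegree h5
    rw [natDegree_intervalPoly, natDegree_intervalPoly] at h6
    omega
  · exact h1.2 (h1.1.antisymm (hA.nearest a haW ⟨h2, hne⟩))

theorem IsAdjacent.starStep [CharZero k] {Z : SubRoots u c} {b : k} {n : ℕ}
    (hA : IsAdjacent Z b n) : StarStep u c Z (starAt Z b (b - n) hA.mem hA.mem_compl) := by
  have h0 := (intervalPoly_monic b n).ne_zero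
  refine ⟨intervalPoly b n, b, hA.minimal, h0, ?_, ?_, hA.mem, b - n, hA.mem_compl,
    smithLT_iff.2 ⟨n, hA.pos, rfl⟩, hA.nearest, rfl⟩
  · rw [mem_roots h0]
    exact isRoot_intervalPoly.2 ⟨0, hA.pos, by simp⟩
  · intro a ha
    obtain ⟨i, -, rfl⟩ := isRoot_intervalPoly.1 ((mem_roots h0).1 ha)
    exact smithLE_iff.2 ⟨i, rfl⟩

/-- A pair with the smallest positive difference works: a generator dividing its interval polynomial
must have the top point `b` as a root, and then contains the whole interval. -/
theorem exists_isAdjacent [IsAlgClosed k] [CharZero k] (hu : u + C c ≠ 0) {Z : SubRoots u c}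
    (hZ : smithEll u c Z ≠ 0) : ∃ b n, IsAdjacent Z b n := by
  classical
  have hex : ∃ n : ℕ, 0 < n ∧ ∃ b ∈ Z.1, b - n ∈ rootCompl u c Z := by
    rw [Ne, smithEll_eq_zero_iff] at hZ
    push Not at hZ
    obtain ⟨b, hb, a, ha, hab⟩ := hZ
    obtain ⟨n, hn, rfl⟩ := smithLT_iff.1 hab
    exact ⟨n, hn, b, hb, ha⟩
  obtain ⟨⟨hn, b, hb, hb'⟩, hmin⟩ := And.intro (Nat.find_spec hex) fun m => Nat.find_min' (m := m) hex
  generalize Nat.find hex = n at hn hb' hmin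
  have hnear : ∀ a ∈ rootCompl u c Z, SmithLT a b → SmithLE a (b - n) := by
    intro a ha hab
    obtain ⟨m, hm, rfl⟩ := smithLT_iff.1 hab
    have := hmin m ⟨hm, b, hb, ha⟩
    exact ⟨m - n, by rw [Nat.cast_sub this]; ring⟩
  refine ⟨b, n, hn, hb, hb', ⟨⟨intervalPoly_mem_smithLattice hb hb', intervalPoly_ne_one b hn⟩,
    ?_⟩, hnear⟩
  rintro s ⟨hsL, hs1⟩ hst
  have hs0 : s ≠ 0 := ne_zero_of_dvd_ne_zero (intervalPoly_monic b n).ne_zero hst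
  have hsM := ((mem_smithLattice_iff hs0).1 hsL).1
  obtain ⟨a, ha⟩ := exists_isRoot_of_monic_ne_one hsM hs1
  obtain ⟨d, hd, hdr, -⟩ := exists_root_mem_above hs0 hsL ha
  obtain ⟨i, hi, rfl⟩ := isRoot_intervalPoly.1 (hdr.dvd hst)
  -- Otherwise `b - i` in `Z` and `b - n` in the complement are at the smaller distance `n - i`.
  have hi0 : i = 0 := by
    have := hmin (n - i) ⟨by omega, b - i, hd, by
      rwa [Nat.cast_sub hi.le, sub_sub_sub_cancel_right]⟩
    omega
  subst hi0
  rw [Nat.cast_zero, sub_zero] at hdr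
  exact eq_of_monic_of_associated hsM (intervalPoly_monic b n) (associated_of_dvd_dvd hst
    (intervalPoly_dvd_of_mem_smithLattice hu hs0 hsL hdr hnear))

open Classical in
/-- One step of the iteration lowers `φ` by one at `b` and leaves it unchanged at the other
roots. -/
theorem IsAdjacent.smithPhi_eq [CharZero k] {Z : SubRoots u c} {b : k} {n : ℕ}
    (hA : IsAdjacent Z b n) {a : k} (ha : a ∈ (u + C c).roots) :
    smithPhi u c Z a = smithPhi u c (starAt Z b (b - n) hA.mem hA.mem_compl) a +
      if a = b then 1 else 0 := by
  have hlt : SmithLT (b - n) b := smithLT_iff.2 ⟨n, hA.pos, rfl⟩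
  rw [(smithPhi_starAt Z hA.mem hA.mem_compl hlt a).1]
  congr 1
  refine if_congr ⟨fun h => hA.eq_of_mem_roots ha h.1 h.2, ?_⟩ rfl rfl
  rintro rfl
  exact ⟨hlt, SmithLE.refl _⟩

theorem IsAdjacent.mem_roots [CharZero k] {Z : SubRoots u c} {b : k} {n : ℕ}
    (hA : IsAdjacent Z b n) : b ∈ (u + C c).roots := (mem_roots_iff_mem_or Z).2 (Or.inl hA.mem)

/-- The sum of φ over the distinct roots drops at each step, so the iteration terminates. -/
theorem exists_isStarEnd [IsAlgClosed k] [CharZero k] (hu : u + C c ≠ 0) (Z : SubRoots u c) :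
    ∃ Zs, IsStarEnd u c Z Zs := by
  classical
  induction hN : ∑ a ∈ distinctRoots u c, smithPhi u c Z a using Nat.strong_induction_on
    generalizing Z with
  | _ N ih =>
    by_cases hZ : smithEll u c Z = 0
    · exact ⟨Z, Relation.ReflTransGen.refl, hZ⟩
    · obtain ⟨b, n, hA⟩ := exists_isAdjacent hu hZ
      have hlt : ∑ a ∈ distinctRoots u c,
          smithPhi u c (starAt Z b (b - n) hA.mem hA.mem_compl) a < N := by
        rw [← hN]
        refine Finset.sum_lt_sum (fun a ha => ?_) ⟨b, (mem_distinctRoots b).2 hA.mem_roots, ?_⟩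
        · rw [hA.smithPhi_eq ((mem_distinctRoots a).1 ha)]
          exact Nat.le_add_right _ _
        · rw [hA.smithPhi_eq hA.mem_roots, if_pos rfl]
          exact Nat.lt_succ_self _
      obtain ⟨Zs, h1, h2⟩ := ih _ hlt _ rfl
      exact ⟨Zs, Relation.ReflTransGen.head hA.starStep h1, h2⟩

/-- A step lowers `cardAbove` and φ by the same amount at every point, so their difference is
invariant, and φ vanishes at the end. -/
theorem IsStarEnd.cardAbove_eq [CharZero k] (hu : u + C c ≠ 0) {Z Zs : SubRoots u c}
    (h : IsStarEnd u c Z Zs) (a : k) :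
    cardAbove Z.1 a = cardAbove Zs.1 a + smithPhi u c Z a := by
  obtain ⟨h1, h2⟩ := h
  induction h1 using Relation.ReflTransGen.head_induction_on with
  | refl => rw [smithPhi_eq_zero_of_smithEll_eq_zero h2, add_zero]
  | head hstep _ ih =>
    obtain ⟨b, n, hA, rfl⟩ := hstep.exists_isAdjacent hu
    obtain ⟨h3, h4⟩ := smithPhi_starAt _ hA.mem hA.mem_compl (smithLT_iff.2 ⟨n, hA.pos, rfl⟩) a
    rw [h3, h4, ih]
    ring

theorem existsUnique_isStarEnd [IsAlgClosed k] [CharZero k] (hu : u + C c ≠ 0)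
    (Z : SubRoots u c) : ∃! Zs, IsStarEnd u c Z Zs := by
  obtain ⟨Zs, h⟩ := exists_isStarEnd hu Z
  refine ⟨Zs, h, fun Y hY => Subtype.ext (ext_of_cardAbove fun a => ?_)⟩
  have h1 := h.cardAbove_eq hu a
  have h2 := hY.cardAbove_eq hu a
  omega

theorem add_C_ne_zero_of_smithG_ne_zero (hg : smithG u ≠ 0) (c : k) : u + C c ≠ 0 := by
  intro h
  apply hg
  rw [eq_neg_of_add_eq_zero_left h, smithG]
  simp

end Lattice

/-! ### Submodules of A_c(Z), simplicity and the socle -/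

section Modules

variable {k : Type u} [Field k] {u : k[X]} {c : k}

theorem SmithAlgebra.induction {u : k[X]} {P : SmithAlgebra u → Prop}
    (halg : ∀ a : k, P (algebraMap k _ a)) (hgen : ∀ a, P (SmithAlgebra.gen u a))
    (hadd : ∀ s t, P s → P t → P (s + t)) (hmul : ∀ s t, P s → P t → P (s * t))
    (s : SmithAlgebra u) : P s := by
  obtain ⟨s, rfl⟩ := RingQuot.mkAlgHom_surjective k (SmithRel u) s
  induction s using FreeAlgebra.induction with
  | grade0 a => rw [AlgHom.commutes]; exact halg a
  | grade1 a => exact hgen a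
  | mul s t hs ht => rw [map_mul]; exact hmul _ _ hs ht
  | add s t hs ht => rw [map_add]; exact hadd _ _ hs ht

/-- The element of `A_c(Z)` given by a polynomial. -/
def SmithA.of (Z : SubRoots u c) (f : k[X]) : SmithA u c Z := f

theorem SmithA.gen_smul (Z : SubRoots u c) (a : SmithGen) (f : k[X]) :
    SmithAlgebra.gen u a • SmithA.of Z f = SmithA.of Z (smithOp u c Z.1 a f) := by
  rw [← smithRep_gen]
  rfl

theorem SmithA.algebraMap_smul (Z : SubRoots u c) (a : k) (f : k[X]) :
    algebraMap k (SmithAlgebra u) a • SmithA.of Z f = SmithA.of Z (C a * f) := by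
  change smithRep u c Z (algebraMap k (SmithAlgebra u) a) f = C a * f
  rw [AlgHom.commutes, Module.algebraMap_end_apply, smul_eq_C_mul]

theorem SmithA.aeval_smul (Z : SubRoots u c) (r f : k[X]) :
    aeval (SmithAlgebra.gen u SmithGen.h) r • SmithA.of Z f = SmithA.of Z (r * f) := by
  change smithRep u c Z (aeval (SmithAlgebra.gen u SmithGen.h) r) f = r * f
  rw [← aeval_algHom_apply, smithRep_gen, aeval_smithOp_h]

theorem smithOp_x (Z : Multiset k) (f : k[X]) :
    smithOp u c Z SmithGen.x f = f.comp (X + 1) * rootPoly Z := by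
  simp [smithOp, shiftMul]

theorem smithOp_y (Z : Multiset k) (f : k[X]) :
    smithOp u c Z SmithGen.y f = f.comp (X - 1) * smithP u c Z := by
  simp [smithOp, shiftMul, sub_eq_add_neg]

theorem smithOp_h (Z : Multiset k) (f : k[X]) : smithOp u c Z SmithGen.h f = X * f := by
  simp [smithOp, shiftMul, mul_comm]

/-- A `k`-linear map that commutes with the generators commutes with the Smith algebra. -/
theorem smithRep_commutes (Z Z' : SubRoots u c) (ψ : k[X] →ₗ[k] k[X])
    (hψ : ∀ a f, ψ (smithOp u c Z.1 a f) = smithOp u c Z'.1 a (ψ f)) (s : SmithAlgebra u)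
    (f : k[X]) : ψ (smithRep u c Z s f) = smithRep u c Z' s (ψ f) := by
  induction s using SmithAlgebra.induction generalizing f with
  | halg a => rw [AlgHom.commutes, AlgHom.commutes, Module.algebraMap_end_apply,
      Module.algebraMap_end_apply, map_smul]
  | hgen a => rw [smithRep_gen, smithRep_gen, hψ]
  | hadd s t hs ht =>
    rw [map_add, map_add, LinearMap.add_apply, LinearMap.add_apply, map_add, hs, ht]
  | hmul s t hs ht =>
    rw [map_mul, map_mul, Module.End.mul_apply, Module.End.mul_apply, hs, ht]

/-- A `k`-linear map between modules `A_c(Z)` that commutes with the generators is linear over the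
Smith algebra. -/
noncomputable def SmithA.homOfCommutes (Z Z' : SubRoots u c) (ψ : k[X] →ₗ[k] k[X])
    (hψ : ∀ a f, ψ (smithOp u c Z.1 a f) = smithOp u c Z'.1 a (ψ f)) :
    SmithA u c Z →ₗ[SmithAlgebra u] SmithA u c Z' where
  toFun f := ψ f
  map_add' f g := ψ.map_add f g
  map_smul' s f := smithRep_commutes Z Z' ψ hψ s f

/-- Every submodule of `A_c(Z)` consists of the multiples of an element of `smithLattice`. -/
theorem SmithA.exists_generator (Z : SubRoots u c)
    (N : Submodule (SmithAlgebra u) (SmithA u c Z)) :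
    ∃ t ∈ smithLattice u c Z, ∀ f : k[X], SmithA.of Z f ∈ N ↔ t ∣ f := by
  let I : Ideal k[X] :=
    { carrier := {f | SmithA.of Z f ∈ N}
      add_mem' := fun {a b} ha hb => N.add_mem ha hb
      zero_mem' := N.zero_mem
      smul_mem' := fun r f hf => by
        have h : aeval (SmithAlgebra.gen u SmithGen.h) r • SmithA.of Z f ∈ N := N.smul_mem _ hf
        rwa [SmithA.aeval_smul] at h }
  have hI : ∀ f : k[X], SmithA.of Z f ∈ N ↔ f ∈ I := fun f => Iff.rfl
  obtain ⟨s, hs⟩ := (IsPrincipalIdealRing.principal I).principal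
  have hs' : ∀ f, f ∈ I ↔ s ∣ f := fun f => by
    rw [hs]; exact Ideal.mem_span_singleton
  classical
  have hassoc : Associated s (normalize s) := associated_normalize s
  -- Normalizing makes a nonzero generator monic and leaves zero unchanged, matching the two parts
  -- of `smithLattice`.
  refine ⟨normalize s, ?_, fun f => by rw [hI, hs', hassoc.dvd_iff_dvd_left]⟩
  by_cases h0 : s = 0
  · right
    simp [h0]
  · left
    have hmem : SmithA.of Z (normalize s) ∈ N := by
      rw [hI, hs']; exact hassoc.dvd
    refine ⟨monic_normalize h0, ?_, ?_⟩
    · have h := N.smul_mem (SmithAlgebra.gen u SmithGen.y) hmem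
      rwa [SmithA.gen_smul, smithOp_y, hI, hs', hassoc.dvd_iff_dvd_left] at h
    · have h := N.smul_mem (SmithAlgebra.gen u SmithGen.x) hmem
      rwa [SmithA.gen_smul, smithOp_x, hI, hs', hassoc.dvd_iff_dvd_left] at h

theorem SmithA.eq_top_of_one_mem {Z : SubRoots u c}
    {N : Submodule (SmithAlgebra u) (SmithA u c Z)} (h : SmithA.of Z 1 ∈ N) : N = ⊤ := by
  obtain ⟨t, -, ht⟩ := SmithA.exists_generator Z N
  refine eq_top_iff.2 fun f _ => (ht f).2 ?_
  exact ((ht 1).1 h).trans (one_dvd _)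

instance (Z : SubRoots u c) : Nontrivial (SmithA u c Z) := inferInstanceAs (Nontrivial k[X])

/-- Two nonzero submodules of `A_c(Z)` meet. -/
theorem SmithA.inf_ne_bot {Z : SubRoots u c} {N N' : Submodule (SmithAlgebra u) (SmithA u c Z)}
    (h : N ≠ ⊥) (h' : N' ≠ ⊥) : N ⊓ N' ≠ ⊥ := by
  obtain ⟨t, -, ht⟩ := SmithA.exists_generator Z N
  obtain ⟨t', -, ht'⟩ := SmithA.exists_generator Z N'
  obtain ⟨f, hf, hf0⟩ := N.ne_bot_iff.1 h
  obtain ⟨f', hf', hf0'⟩ := N'.ne_bot_iff.1 h'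
  rw [Submodule.ne_bot_iff]
  refine ⟨SmithA.of Z ((show k[X] from f) * (show k[X] from f')), ⟨?_, ?_⟩, ?_⟩
  · exact (ht _).2 (((ht _).1 hf).mul_right _)
  · exact (ht' _).2 (((ht' _).1 hf').mul_left _)
  · exact mul_ne_zero (M₀ := k[X]) hf0 hf0'

theorem SmithA.isSimpleModule [IsAlgClosed k] [CharZero k] (hu : u + C c ≠ 0) {Z : SubRoots u c}
    (hZ : smithEll u c Z = 0) : IsSimpleModule (SmithAlgebra u) (SmithA u c Z) := by
  rw [isSimpleModule_iff]
  refine ⟨fun N => ?_⟩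
  obtain ⟨t, htL, ht⟩ := SmithA.exists_generator Z N
  by_cases h0 : t = 0
  · left
    refine (Submodule.eq_bot_iff N).2 fun f hf => ?_
    exact zero_dvd_iff.1 (h0 ▸ (ht f).1 hf)
  · right
    refine SmithA.eq_top_of_one_mem ((ht 1).2 ?_)
    rw [eq_one_of_mem_smithLattice hu hZ h0 htL]

/-- The embedding `A_c(Z ⋆ b) → A_c(Z)`. -/
noncomputable def SmithA.starHom (Z : SubRoots u c) {b : k} {n : ℕ} (hb : b ∈ Z.1)
    (hb' : b - n ∈ rootCompl u c Z) :
    SmithA u c (starAt Z b (b - n) hb hb') →ₗ[SmithAlgebra u] SmithA u c Z :=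
  SmithA.homOfCommutes _ _ (LinearMap.mulRight k (intervalPoly b n)) fun a f => by
    simp only [LinearMap.mulRight_apply]
    cases a with
    | x =>
      rw [smithOp_x, smithOp_x, mul_comp]
      linear_combination f.comp (X + 1) * rootPoly_starAt_mul Z hb hb'
    | y =>
      rw [smithOp_y, smithOp_y, mul_comp]
      linear_combination f.comp (X - 1) * smithP_starAt_mul Z hb hb'
    | h =>
      rw [smithOp_h, smithOp_h]
      ring

theorem SmithA.starHom_apply (Z : SubRoots u c) {b : k} {n : ℕ} (hb : b ∈ Z.1)
    (hb' : b - n ∈ rootCompl u c Z) (f : k[X]) :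
    SmithA.starHom Z hb hb' (SmithA.of _ f) = SmithA.of Z (f * intervalPoly b n) := rfl

theorem SmithA.starHom_injective (Z : SubRoots u c) {b : k} {n : ℕ} (hb : b ∈ Z.1)
    (hb' : b - n ∈ rootCompl u c Z) : Function.Injective (SmithA.starHom Z hb hb') :=
  mul_left_injective₀ (M₀ := k[X]) (intervalPoly_monic b n).ne_zero

theorem SmithA.mem_range_starHom (Z : SubRoots u c) {b : k} {n : ℕ} (hb : b ∈ Z.1)
    (hb' : b - n ∈ rootCompl u c Z) (f : k[X]) :
    SmithA.of Z f ∈ LinearMap.range (SmithA.starHom Z hb hb') ↔ intervalPoly b n ∣ f := by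
  constructor
  · rintro ⟨g, hg⟩
    exact Dvd.intro_left (show k[X] from g) hg
  · rintro ⟨g, rfl⟩
    exact ⟨SmithA.of _ g, (SmithA.starHom_apply Z hb hb' g).trans
      (congrArg (SmithA.of Z) (mul_comm _ _))⟩

/-- Inclusion of submodules is divisibility of generators reversed, so a minimal generator other
than 1 gives a maximal proper submodule. -/
theorem IsAdjacent.isCoatom_range {Z : SubRoots u c} {b : k} {n : ℕ} (hA : IsAdjacent Z b n) :
    IsCoatom (LinearMap.range (SmithA.starHom Z hA.mem hA.mem_compl)) := by
  constructor
  · intro h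
    have h1 : intervalPoly b n ∣ 1 := by
      rw [← SmithA.mem_range_starHom Z hA.mem hA.mem_compl, h]
      exact Submodule.mem_top
    exact intervalPoly_ne_one b hA.pos
      ((intervalPoly_monic b n).eq_one_of_isUnit (isUnit_of_dvd_one h1))
  · intro N hN
    obtain ⟨s, hsL, hs⟩ := SmithA.exists_generator Z N
    by_cases h1 : s = 1
    · exact SmithA.eq_top_of_one_mem ((hs 1).2 (h1 ▸ dvd_rfl))
    · exfalso
      have h2 : s ∣ intervalPoly b n := (hs _).1 (hN.le
        ((SmithA.mem_range_starHom Z hA.mem hA.mem_compl _).2 dvd_rfl))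
      have h3 := hA.minimal.2 s ⟨hsL, h1⟩ h2
      refine hN.not_ge fun f hf => ?_
      exact (SmithA.mem_range_starHom Z hA.mem hA.mem_compl f).2 (h3 ▸ (hs f).1 hf)

/-- The end point of the iteration embeds into `A_c(Z)`. -/
theorem IsStarEnd.exists_injective [CharZero k] (hu : u + C c ≠ 0) {Z Zs : SubRoots u c}
    (h : IsStarEnd u c Z Zs) :
    ∃ φ : SmithA u c Zs →ₗ[SmithAlgebra u] SmithA u c Z, Function.Injective φ := by
  obtain ⟨h1, -⟩ := h
  induction h1 using Relation.ReflTransGen.head_induction_on with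
  | refl => exact ⟨LinearMap.id, Function.injective_id⟩
  | head hstep _ ih =>
    obtain ⟨b, n, hA, rfl⟩ := hstep.exists_isAdjacent hu
    obtain ⟨φ, hφ⟩ := ih
    exact ⟨(SmithA.starHom _ hA.mem hA.mem_compl).comp φ,
      (SmithA.starHom_injective _ hA.mem hA.mem_compl).comp hφ⟩

/-- The image of the simple end point meets every simple submodule, hence is the only one. -/
theorem IsStarEnd.nonempty_socle_equiv [IsAlgClosed k] [CharZero k] (hu : u + C c ≠ 0)
    {Z Zs : SubRoots u c} (h : IsStarEnd u c Z Zs) :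
    Nonempty (moduleSocle (SmithAlgebra u) (SmithA u c Z) ≃ₗ[SmithAlgebra u] SmithA u c Zs) := by
  obtain ⟨φ, hφ⟩ := h.exists_injective hu
  have e := LinearEquiv.ofInjective φ hφ
  have hsimple := SmithA.isSimpleModule hu h.2
  have hN : IsSimpleModule (SmithAlgebra u) (LinearMap.range φ) := IsSimpleModule.congr e.symm
  have hsoc : moduleSocle (SmithAlgebra u) (SmithA u c Z) = LinearMap.range φ := by
    refine le_antisymm (sSup_le fun N' hN' => ?_) (le_sSup hN)
    have h1 := isSimpleModule_iff_isAtom.1 hN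
    have h2 : IsAtom N' := isSimpleModule_iff_isAtom.1 hN'
    have h3 := SmithA.inf_ne_bot h1.1 h2.1
    rcases h2.le_iff.1 (inf_le_right : LinearMap.range φ ⊓ N' ≤ N') with h4 | h4
    · exact absurd h4 h3
    · exact inf_eq_right.1 h4
  rw [hsoc]
  exact ⟨e.symm⟩

end Modules

/-! ### Modules generated by a highest weight vector -/

section HighestWeight

variable {k : Type u} [Field k] {u : k[X]} {M : Type u} [AddCommGroup M]
  [Module (SmithAlgebra u) M]

/-- `v` is a vector of weight `b` that is annihilated by `y`. -/
structure IsHighestWeight (b : k) (v : M) : Prop where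
  h_smul : SmithAlgebra.gen u SmithGen.h • v = algebraMap k (SmithAlgebra u) b • v
  y_smul : SmithAlgebra.gen u SmithGen.y • v = 0

theorem SmithAlgebra.h_mul_x : SmithAlgebra.gen u SmithGen.h * SmithAlgebra.gen u SmithGen.x =
    SmithAlgebra.gen u SmithGen.x * SmithAlgebra.gen u SmithGen.h -
      SmithAlgebra.gen u SmithGen.x := by
  have h := RingQuot.mkAlgHom_rel k (SmithRel.hx (u := u))
  rw [map_sub, map_mul, map_mul, map_neg] at h
  rw [sub_eq_add_neg]
  exact eq_add_of_sub_eq' h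

theorem SmithAlgebra.y_mul_x : SmithAlgebra.gen u SmithGen.y * SmithAlgebra.gen u SmithGen.x =
    SmithAlgebra.gen u SmithGen.x * SmithAlgebra.gen u SmithGen.y +
      aeval (SmithAlgebra.gen u SmithGen.h) (smithG u) := by
  have h := RingQuot.mkAlgHom_rel k (SmithRel.yx (u := u))
  rw [map_sub, map_mul, map_mul, ← aeval_algHom_apply] at h
  exact eq_add_of_sub_eq' h

variable [Module k M] [IsScalarTower k (SmithAlgebra u) M]

/-- Polynomials in `h` act on a weight vector by evaluation. -/
theorem aeval_h_smul {b : k} {v : M} (hv : SmithAlgebra.gen u SmithGen.h • v = b • v) (f : k[X]) :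
    aeval (SmithAlgebra.gen u SmithGen.h) f • v = f.eval b • v := by
  induction f using Polynomial.induction_on with
  | C a => rw [aeval_C, eval_C, algebraMap_smul]
  | add f g hf hg => rw [map_add, add_smul, hf, hg, eval_add, add_smul]
  | monomial n a ih =>
    rw [pow_succ, ← mul_assoc, map_mul, aeval_X, mul_smul, hv, smul_algebra_smul_comm, ih, smul_smul,
      eval_mul (q := X), eval_X, mul_comm]

namespace IsHighestWeight

variable {b : k} {v : M}

theorem h_smul' (hv : IsHighestWeight (u := u) b v) :
    SmithAlgebra.gen u SmithGen.h • v = b • v := by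
  rw [hv.h_smul, algebraMap_smul]

theorem h_smul_x_pow (hv : IsHighestWeight (u := u) b v) (i : ℕ) :
    SmithAlgebra.gen u SmithGen.h • (SmithAlgebra.gen u SmithGen.x ^ i • v) =
      (b - i) • (SmithAlgebra.gen u SmithGen.x ^ i • v) := by
  induction i with
  | zero => simpa using hv.h_smul'
  | succ i ih =>
    rw [pow_succ', mul_smul, ← mul_smul, SmithAlgebra.h_mul_x, sub_smul, mul_smul, ih,
      smul_algebra_smul_comm, Nat.cast_succ, ← sub_sub, sub_smul (b - (i : k)), one_smul]

theorem y_smul_x_pow_mem (hv : IsHighestWeight (u := u) b v) (i : ℕ) :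
    SmithAlgebra.gen u SmithGen.y • (SmithAlgebra.gen u SmithGen.x ^ i • v) ∈
      Submodule.span k (Set.range fun j : ℕ => SmithAlgebra.gen u SmithGen.x ^ j • v) := by
  induction i with
  | zero => rw [pow_zero, one_smul, hv.y_smul]; exact zero_mem _
  | succ i ih =>
    -- Moving `y` past one `x` gives y xⁱ⁺¹ v = x (y xⁱ v) + g(b - i) xⁱ v.
    rw [pow_succ', mul_smul, ← mul_smul, SmithAlgebra.y_mul_x, add_smul, mul_smul,
      aeval_h_smul (hv.h_smul_x_pow i)]
    refine add_mem ?_ (Submodule.smul_mem _ _ (Submodule.subset_span ⟨i, rfl⟩))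
    generalize SmithAlgebra.gen u SmithGen.y • SmithAlgebra.gen u SmithGen.x ^ i • v = w at ih
    induction ih using Submodule.span_induction with
    | mem w hw =>
      obtain ⟨j, rfl⟩ := hw
      exact Submodule.subset_span ⟨j + 1, by simp only [pow_succ', mul_smul]⟩
    | zero => rw [smul_zero]; exact zero_mem _
    | add w w' _ _ h h' => rw [smul_add]; exact add_mem h h'
    | smul a w _ h => rw [smul_algebra_smul_comm]; exact Submodule.smul_mem _ _ h

/-- A module generated by a highest weight vector `v` is spanned by the vectors `xⁱ v`. -/
theorem mem_span_x_pow (hv : IsHighestWeight (u := u) b v) (s : SmithAlgebra u) :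
    s • v ∈ Submodule.span k (Set.range fun j : ℕ => SmithAlgebra.gen u SmithGen.x ^ j • v) := by
  suffices h : ∀ w ∈ Submodule.span k
      (Set.range fun j : ℕ => SmithAlgebra.gen u SmithGen.x ^ j • v), s • w ∈ Submodule.span k
      (Set.range fun j : ℕ => SmithAlgebra.gen u SmithGen.x ^ j • v) from
    h v (Submodule.subset_span ⟨0, by simp⟩)
  induction s using SmithAlgebra.induction with
  | halg a => intro w hw; rw [algebraMap_smul]; exact Submodule.smul_mem _ _ hw
  | hgen a =>
    intro w hw
    induction hw using Submodule.span_induction with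
    | mem w hw =>
      obtain ⟨j, rfl⟩ := hw
      cases a with
      | x => exact Submodule.subset_span ⟨j + 1, by simp only [pow_succ', mul_smul]⟩
      | y => exact hv.y_smul_x_pow_mem j
      | h =>
        simp only [hv.h_smul_x_pow j]
        exact Submodule.smul_mem _ _ (Submodule.subset_span ⟨j, rfl⟩)
    | zero => rw [smul_zero]; exact zero_mem _
    | add w w' _ _ h h' => rw [smul_add]; exact add_mem h h'
    | smul a w _ h => rw [smul_algebra_smul_comm]; exact Submodule.smul_mem _ _ h
  | hadd s t hs ht => intro w hw; rw [add_smul]; exact add_mem (hs w hw) (ht w hw)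
  | hmul s t hs ht => intro w hw; rw [mul_smul]; exact hs _ (ht w hw)

/-- Up to a multiple of `v`, every element is killed by the product of the `h - (b - i)`, `i ≥ 1`. -/
theorem exists_aeval_smul_eq (hv : IsHighestWeight (u := u) b v) (s : SmithAlgebra u) :
    ∃ (a : k) (N : ℕ), ∀ n ≥ N, aeval (SmithAlgebra.gen u SmithGen.h) (intervalPoly (b - 1) n) •
      (s • v) = (a * (intervalPoly (b - 1) n).eval b) • v := by
  have h := hv.mem_span_x_pow s
  generalize s • v = w at h
  -- The witness `a` is the coefficient of `v` in an expression of `s • v` through the xⁱ v, and `N`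
  -- bounds the exponents that occur.
  induction h using Submodule.span_induction with
  | mem w hw =>
    obtain ⟨i, rfl⟩ := hw
    rcases i with _ | i
    · refine ⟨1, 0, fun n _ => ?_⟩
      simp only [pow_zero, one_smul, aeval_h_smul hv.h_smul', one_mul]
    · refine ⟨0, i + 1, fun n hn => ?_⟩
      have h1 : (intervalPoly (b - 1) n).IsRoot (b - (i + 1 : ℕ)) :=
        isRoot_intervalPoly.2 ⟨i, hn, by push_cast; ring⟩
      simp only [aeval_h_smul (hv.h_smul_x_pow (i + 1))]
      rw [h1, zero_smul, zero_mul, zero_smul]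
  | zero => exact ⟨0, 0, fun n _ => by rw [smul_zero, zero_mul, zero_smul]⟩
  | add w w' _ _ h h' =>
    obtain ⟨a, N, ha⟩ := h
    obtain ⟨a', N', ha'⟩ := h'
    refine ⟨a + a', max N N', fun n hn => ?_⟩
    rw [smul_add, ha n (le_trans (le_max_left _ _) hn), ha' n (le_trans (le_max_right _ _) hn),
      add_mul, add_smul]
  | smul d w _ h =>
    obtain ⟨a, N, ha⟩ := h
    exact ⟨d * a, N, fun n hn => by
      rw [smul_algebra_smul_comm, ha n hn, smul_smul, mul_assoc]⟩

theorem eval_intervalPoly_ne_zero [CharZero k] (b : k) (n : ℕ) :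
    (intervalPoly (b - 1) n).eval b ≠ 0 := by
  intro h
  obtain ⟨i, -, hi⟩ := isRoot_intervalPoly.1 h
  have h1 : ((i + 1 : ℕ) : k) = 0 := by push_cast; linear_combination hi
  exact absurd (Nat.cast_eq_zero.1 h1) (by omega)

/-- The sum of all proper submodules of a module generated by a nonzero highest weight vector does
not contain this vector. -/
theorem sSup_ne_top [CharZero k] (hv : IsHighestWeight (u := u) b v)
    (hgen : ∀ w : M, ∃ s : SmithAlgebra u, s • v = w) (h0 : v ≠ 0) :
    sSup {N : Submodule (SmithAlgebra u) M | N ≠ ⊤} ≠ ⊤ := by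
  intro htop
  -- Being killed by these polynomials for all large `n` passes to sums, unlike lying in a proper
  -- submodule. An element of a proper submodule has it, for otherwise a nonzero multiple of `v`
  -- would lie there.
  have hkill : ∀ w ∈ sSup {N : Submodule (SmithAlgebra u) M | N ≠ ⊤}, ∃ N : ℕ, ∀ n ≥ N,
      aeval (SmithAlgebra.gen u SmithGen.h) (intervalPoly (b - 1) n) • w = 0 := by
    intro w hw
    rw [sSup_eq_iSup'] at hw
    induction hw using Submodule.iSup_induction' with
    | mem N w hw =>
      obtain ⟨s, rfl⟩ := hgen w
      obtain ⟨a, n₀, ha⟩ := hv.exists_aeval_smul_eq s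
      refine ⟨n₀, fun n hn => ?_⟩
      rw [ha n hn]
      by_contra hne
      have hd : a * (intervalPoly (b - 1) n).eval b ≠ 0 := fun h => hne (by rw [h, zero_smul])
      refine N.2 (eq_top_iff.2 fun w' _ => ?_)
      have h1 := N.1.smul_mem (aeval (SmithAlgebra.gen u SmithGen.h) (intervalPoly (b - 1) n)) hw
      rw [ha n hn] at h1
      have h2 := N.1.smul_mem (algebraMap k _ (a * (intervalPoly (b - 1) n).eval b)⁻¹) h1
      rw [algebraMap_smul, smul_smul, inv_mul_cancel₀ hd, one_smul] at h2
      obtain ⟨s', rfl⟩ := hgen w'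
      exact N.1.smul_mem s' h2
    | zero => exact ⟨0, fun n _ => smul_zero _⟩
    | add w w' _ _ h h' =>
      obtain ⟨N, hN⟩ := h
      obtain ⟨N', hN'⟩ := h'
      exact ⟨max N N', fun n hn => by
        rw [smul_add, hN n (le_trans (le_max_left _ _) hn),
          hN' n (le_trans (le_max_right _ _) hn), add_zero]⟩
  obtain ⟨n, hn⟩ := hkill v (by rw [htop]; exact Submodule.mem_top)
  have h1 := hn n le_rfl
  rw [aeval_h_smul hv.h_smul'] at h1
  exact (smul_eq_zero.1 h1).elim (eval_intervalPoly_ne_zero b n) h0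

/-- The weights of a module generated by a vector of highest weight `b` are `≼ b`. -/
theorem smithLE_of_weight (hv : IsHighestWeight (u := u) b v)
    (hgen : ∀ w : M, ∃ s : SmithAlgebra u, s • v = w) {d : k} {w : M} (hw : w ≠ 0)
    (hd : SmithAlgebra.gen u SmithGen.h • w = d • w) : SmithLE d b := by
  obtain ⟨s, hs⟩ := hgen w
  obtain ⟨a, n, ha⟩ := hv.exists_aeval_smul_eq s
  -- The additional factor `X - C b` kills the remaining multiple of `v`.
  have h1 : aeval (SmithAlgebra.gen u SmithGen.h) (intervalPoly b (n + 1)) • w = 0 := by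
    rw [intervalPoly_succ, mul_comm, map_mul, mul_smul, ← hs, ha n le_rfl, smul_algebra_smul_comm,
      aeval_h_smul hv.h_smul', eval_sub, eval_X, eval_C, sub_self, zero_smul, smul_zero]
  rw [aeval_h_smul hd] at h1
  obtain ⟨i, -, rfl⟩ := isRoot_intervalPoly.1 ((smul_eq_zero.1 h1).resolve_right hw)
  exact smithLE_iff.2 ⟨i, rfl⟩

end IsHighestWeight

end HighestWeight

/-! ### Verma modules and the identification of the quotients with L(b) -/

section Verma

variable {k : Type u} [Field k] {u : k[X]}

/-- The canonical generator of the Verma module. -/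
def SmithVerma.vec (u : k[X]) (b : k) : SmithVerma u b := Submodule.Quotient.mk 1

theorem SmithVerma.smul_vec (b : k) (s : SmithAlgebra u) :
    s • SmithVerma.vec u b = Submodule.Quotient.mk s := by
  rw [SmithVerma.vec, ← Submodule.Quotient.mk_smul, smul_eq_mul, mul_one]

theorem SmithVerma.exists_smul_vec (b : k) (w : SmithVerma u b) :
    ∃ s : SmithAlgebra u, s • SmithVerma.vec u b = w := by
  obtain ⟨s, rfl⟩ := Submodule.Quotient.mk_surjective _ w
  exact ⟨s, SmithVerma.smul_vec b s⟩

theorem SmithVerma.isHighestWeight (b : k) :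
    IsHighestWeight (u := u) b (SmithVerma.vec u b) where
  h_smul := by
    rw [SmithVerma.smul_vec, SmithVerma.smul_vec, Submodule.Quotient.eq]
    exact Submodule.subset_span (by simp)
  y_smul := by
    rw [SmithVerma.smul_vec, Submodule.Quotient.mk_eq_zero]
    exact Submodule.subset_span (by simp)

/-- The sum of all proper submodules is proper by `IsHighestWeight.sSup_ne_top` and contains the
coatom `K`, so it equals `K`. -/
theorem SmithVerma.maxSubmodule_eq [CharZero k] {b : k}
    {K : Submodule (SmithAlgebra u) (SmithVerma u b)} (hK : IsCoatom K) :
    SmithVerma.maxSubmodule u b = K := by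
  have h0 : SmithVerma.vec u b ≠ 0 := by
    intro h
    refine hK.1 (eq_top_iff.2 fun w _ => ?_)
    obtain ⟨s, rfl⟩ := SmithVerma.exists_smul_vec b w
    rw [h, smul_zero]
    exact K.zero_mem
  have hne := (SmithVerma.isHighestWeight b).sSup_ne_top (SmithVerma.exists_smul_vec b) h0
  exact (hK.le_iff.1 (le_sSup (show K ∈ {N | N ≠ ⊤} from hK.1))).resolve_left hne

/-- A simple module with a highest weight vector of weight `b` is isomorphic to `L(b)`. -/
theorem IsHighestWeight.nonempty_equiv_smithL [CharZero k] {M : Type u} [AddCommGroup M]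
    [Module (SmithAlgebra u) M] [IsSimpleModule (SmithAlgebra u) M] {b : k} {v : M}
    (hv : IsHighestWeight (u := u) b v) (h0 : v ≠ 0) :
    Nonempty (M ≃ₗ[SmithAlgebra u] SmithL u b) := by
  let π : SmithVerma u b →ₗ[SmithAlgebra u] M :=
    Submodule.liftQ _ (LinearMap.toSpanSingleton (SmithAlgebra u) M v) (by
      rw [Submodule.span_le]
      rintro s (rfl | rfl)
      · exact hv.y_smul
      · change (_ - _ : SmithAlgebra u) • v = 0
        rw [sub_smul, hv.h_smul, sub_self])
  have hπv : π (SmithVerma.vec u b) = v := by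
    change (1 : SmithAlgebra u) • v = v
    rw [one_smul]
  have hsurj : Function.Surjective π := by
    rw [← LinearMap.range_eq_top]
    refine (eq_bot_or_eq_top _).resolve_left fun h => h0 ?_
    have hmem := LinearMap.mem_range_self π (SmithVerma.vec u b)
    rwa [h, Submodule.mem_bot, hπv] at hmem
  let e := π.quotKerEquivOfSurjective hsurj
  have hcoatom : IsCoatom (LinearMap.ker π) :=
    isSimpleModule_iff_isCoatom.1 (IsSimpleModule.congr e)
  exact ⟨e.symm.trans (Submodule.quotEquivOfEq _ _ (SmithVerma.maxSubmodule_eq hcoatom).symm)⟩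

/-- The canonical generator of `L(b)`. -/
def SmithL.vec (u : k[X]) (b : k) : SmithL u b := Submodule.Quotient.mk (SmithVerma.vec u b)

theorem SmithL.exists_smul_vec (b : k) (w : SmithL u b) :
    ∃ s : SmithAlgebra u, s • SmithL.vec u b = w := by
  obtain ⟨w, rfl⟩ := Submodule.Quotient.mk_surjective _ w
  obtain ⟨s, rfl⟩ := SmithVerma.exists_smul_vec b w
  exact ⟨s, rfl⟩

theorem SmithL.isHighestWeight (b : k) : IsHighestWeight (u := u) b (SmithL.vec u b) where
  h_smul := congrArg Submodule.Quotient.mk (SmithVerma.isHighestWeight b).h_smul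
  y_smul := congrArg Submodule.Quotient.mk (SmithVerma.isHighestWeight b).y_smul

theorem SmithL.vec_ne_zero (b : k) [Nontrivial (SmithL u b)] : SmithL.vec u b ≠ 0 := by
  intro h
  obtain ⟨w, hw⟩ := exists_ne (0 : SmithL u b)
  obtain ⟨s, rfl⟩ := SmithL.exists_smul_vec b w
  exact hw (by rw [h, smul_zero])

theorem SmithL.smithLE_of_equiv {b d : k} [Nontrivial (SmithL u d)]
    (e : SmithL u d ≃ₗ[SmithAlgebra u] SmithL u b) : SmithLE d b := by
  refine (SmithL.isHighestWeight b).smithLE_of_weight (SmithL.exists_smul_vec b)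
    (w := e (SmithL.vec u d)) (fun h => SmithL.vec_ne_zero d (e.map_eq_zero_iff.1 h)) ?_
  rw [← map_smul, (SmithL.isHighestWeight d).h_smul, map_smul, algebraMap_smul]

/-- An isomorphism carries each highest weight to a weight of the other module, so each is `≼` the
other. -/
theorem SmithL.eq_of_equiv [CharZero k] {b d : k} [Nontrivial (SmithL u d)]
    (e : SmithL u d ≃ₗ[SmithAlgebra u] SmithL u b) : d = b := by
  have := e.symm.toEquiv.nontrivial
  exact (SmithL.smithLE_of_equiv e).antisymm (SmithL.smithLE_of_equiv e.symm)

variable {c : k}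

/-- The modules `A_c(Z)` have no weight vectors, so they are not isomorphic to any `L(b)`. -/
theorem SmithA.isEmpty_equiv_smithL (Z : SubRoots u c) (b : k) :
    IsEmpty (SmithA u c Z ≃ₗ[SmithAlgebra u] SmithL u b) := by
  refine ⟨fun e => ?_⟩
  have := e.symm.toEquiv.nontrivial
  have h1 := congrArg e.symm (SmithL.isHighestWeight (u := u) b).h_smul
  rw [map_smul, map_smul] at h1
  have h2 : e.symm (SmithL.vec u b) ≠ 0 := fun h =>
    SmithL.vec_ne_zero b (e.symm.map_eq_zero_iff.1 h)
  obtain ⟨f, hf⟩ : ∃ f : k[X], SmithA.of Z f = e.symm (SmithL.vec u b) := ⟨_, rfl⟩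
  rw [← hf] at h1 h2
  rw [SmithA.gen_smul, SmithA.algebraMap_smul, smithOp_h] at h1
  have h3 : (X : k[X]) * f = C b * f := h1
  have h4 : (X - C b) * f = 0 := by rw [sub_mul, h3, sub_self]
  exact h2 ((mul_eq_zero.1 h4).resolve_left (X_sub_C_ne_zero b))

/-- The quotient of `A_c(Z)` by `A_c(Z ⋆ b)` is isomorphic to `L(b)`. -/
theorem IsAdjacent.nonempty_quotient_equiv [CharZero k] (hu : u + C c ≠ 0) {Z : SubRoots u c}
    {b : k} {n : ℕ} (hA : IsAdjacent Z b n) :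
    Nonempty ((SmithA u c Z ⧸ LinearMap.range (SmithA.starHom Z hA.mem hA.mem_compl))
      ≃ₗ[SmithAlgebra u] SmithL u b) := by
  have hmem := SmithA.mem_range_starHom Z hA.mem hA.mem_compl
  have : IsSimpleModule (SmithAlgebra u)
      (SmithA u c Z ⧸ LinearMap.range (SmithA.starHom Z hA.mem hA.mem_compl)) :=
    isSimpleModule_iff_isCoatom.2 hA.isCoatom_range
  obtain ⟨m, rfl⟩ := Nat.exists_eq_succ_of_ne_zero hA.pos.ne'
  -- The vector is t/(h - b), with t = `intervalPoly b (m + 1)`. Multiplication by `h - b` gives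
  -- `t`. Applying `y` gives `intervalPoly b m` times p, and p vanishes at the missing root `b - m`
  -- because `b - (m + 1)` is in the complement.
  have hv : IsHighestWeight (u := u) b (Submodule.Quotient.mk (SmithA.of Z (intervalPoly (b - 1) m)) :
      SmithA u c Z ⧸ LinearMap.range (SmithA.starHom Z hA.mem hA.mem_compl)) := by
    constructor
    · rw [← Submodule.Quotient.mk_smul, ← Submodule.Quotient.mk_smul, Submodule.Quotient.eq,
        SmithA.gen_smul, SmithA.algebraMap_smul, smithOp_h]
      refine (hmem _).2 (dvd_of_eq ?_)
      rw [intervalPoly_succ, mul_comm, sub_mul]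
      rfl
    · rw [← Submodule.Quotient.mk_smul, Submodule.Quotient.mk_eq_zero, SmithA.gen_smul, smithOp_y,
        hmem]
      have h1 : (X - C (b - (m + 1 : ℕ) + 1)) ∣ smithP u c Z.1 := by
        rw [dvd_iff_isRoot, isRoot_smithP_iff hu, add_sub_cancel_right]
        exact hA.mem_compl
      have h2 : (intervalPoly (b - 1) m).comp (X - 1) = intervalPoly b m := by
        have h3 := intervalPoly_comp b m
        rw [← h3, comp_assoc]
        simp
      rw [h2]
      have h4 : intervalPoly b (m + 1) = intervalPoly b m * (X - C (b - (m + 1 : ℕ) + 1)) := by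
        rw [intervalPoly, Finset.prod_range_succ, intervalPoly]
        congr 3
        push_cast
        ring
      change intervalPoly b (m + 1) ∣ _
      rw [h4]
      exact mul_dvd_mul_left _ h1
  refine hv.nonempty_equiv_smithL fun h => ?_
  rw [Submodule.Quotient.mk_eq_zero, hmem] at h
  have h5 := natDegree_le_of_dvd h (intervalPoly_monic _ _).ne_zero
  rw [natDegree_intervalPoly, natDegree_intervalPoly] at h5
  omega

/-- Division with remainder by `intervalPoly b n` represents each class of the quotient by a
polynomial of degree less than `n`. -/
theorem IsAdjacent.finite_smithL [CharZero k] (hu : u + C c ≠ 0) {Z : SubRoots u c}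
    {b : k} {n : ℕ} (hA : IsAdjacent Z b n) : Module.Finite k (SmithL u b) := by
  obtain ⟨e⟩ := hA.nonempty_quotient_equiv hu
  let w : SmithL u b := e (Submodule.Quotient.mk (SmithA.of Z 1))
  let F : k[X] →ₗ[k] SmithL u b :=
    ((LinearMap.toSpanSingleton (SmithAlgebra u) (SmithL u b) w).restrictScalars k).comp
      (aeval (SmithAlgebra.gen u SmithGen.h)).toLinearMap
  have hF : ∀ f, F f = e (Submodule.Quotient.mk (SmithA.of Z f)) := by
    intro f
    change aeval (SmithAlgebra.gen u SmithGen.h) f • w = _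
    rw [← map_smul, ← Submodule.Quotient.mk_smul, SmithA.aeval_smul, mul_one]
  refine Module.Finite.of_surjective (F.domRestrict (degreeLT k n)) fun m => ?_
  obtain ⟨q, rfl⟩ := e.surjective m
  obtain ⟨f, rfl⟩ := Submodule.Quotient.mk_surjective _ q
  have ht := intervalPoly_monic b n
  refine ⟨⟨(show k[X] from f) %ₘ intervalPoly b n, ?_⟩, ?_⟩
  · rw [mem_degreeLT]
    refine (degree_modByMonic_lt _ ht).trans_le (le_of_eq ?_)
    rw [degree_eq_natDegree ht.ne_zero, natDegree_intervalPoly]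
  · rw [LinearMap.domRestrict_apply, hF]
    congr 1
    rw [Submodule.Quotient.eq]
    refine (SmithA.mem_range_starHom Z hA.mem hA.mem_compl
      ((show k[X] from f) %ₘ intervalPoly b n - (show k[X] from f))).2 ?_
    rw [modByMonic_eq_sub_mul_div]
    exact ⟨-((show k[X] from f) /ₘ intervalPoly b n), by ring⟩

end Verma

/-! ### The Grothendieck group, multiplicities and the main theorem -/

section Main

/-- The class in `K_0` is additive along a submodule given by an injective map. -/
theorem K0Class_eq_add {S : Type u} [Ring S] {M' M M'' : Type u} [AddCommGroup M'] [Module S M']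
    [AddCommGroup M] [Module S M] [AddCommGroup M''] [Module S M''] [Module.Finite S M']
    [Module.Finite S M] [Module.Finite S M''] (φ : M' →ₗ[S] M) (hφ : Function.Injective φ)
    (e : (M ⧸ LinearMap.range φ) ≃ₗ[S] M'') :
    K0Class S M = K0Class S M' + K0Class S M'' := by
  have h : isoClass S (FGModuleCat.of S M) - isoClass S (FGModuleCat.of S M') -
      isoClass S (FGModuleCat.of S M'') ∈ exactRelations S := by
    refine AddSubgroup.subset_closure ⟨FGModuleCat.of S M', FGModuleCat.of S M,
      FGModuleCat.of S M'', φ, e.toLinearMap.comp (LinearMap.range φ).mkQ, hφ, ?_, ?_, rfl⟩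
    · rw [LinearMap.exact_iff, LinearEquiv.ker_comp, Submodule.ker_mkQ]
    · exact e.surjective.comp (Submodule.mkQ_surjective _)
  have h1 := (QuotientAddGroup.eq_zero_iff _).2 h
  rw [QuotientAddGroup.mk_sub, QuotientAddGroup.mk_sub, sub_sub, sub_eq_zero] at h1
  exact h1

variable {k : Type u} [Field k] {u : k[X]} {c : k}

theorem IsStarEnd.K0Class_eq [CharZero k] (hu : u + C c ≠ 0) {Z Zs : SubRoots u c}
    (h : IsStarEnd u c Z Zs) :
    K0Class (SmithAlgebra u) (SmithA u c Z) = K0Class (SmithAlgebra u) (SmithA u c Zs) +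
      ∑ b ∈ distinctRoots u c, smithPhi u c Z b • K0Class (SmithAlgebra u) (SmithL u b) := by
  classical
  obtain ⟨h1, h2⟩ := h
  induction h1 using Relation.ReflTransGen.head_induction_on with
  | refl => simp [smithPhi_eq_zero_of_smithEll_eq_zero h2]
  | head hstep _ ih =>
    obtain ⟨b, n, hA, rfl⟩ := hstep.exists_isAdjacent hu
    obtain ⟨e⟩ := hA.nonempty_quotient_equiv hu
    rw [K0Class_eq_add _ (SmithA.starHom_injective _ hA.mem hA.mem_compl) e, ih, add_assoc]
    congr 1
    have hsum : ∀ a ∈ distinctRoots u c,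
        smithPhi u c _ a • K0Class (SmithAlgebra u) (SmithL u a) = _ := fun a ha => by
      rw [hA.smithPhi_eq ((mem_distinctRoots a).1 ha), add_smul, ite_smul, one_smul, zero_smul]
    rw [Finset.sum_congr rfl hsum, Finset.sum_add_distrib, Finset.sum_ite_eq' _ b,
      if_pos ((mem_distinctRoots b).2 hA.mem_roots)]

/-- A positive φ(b) must reach zero, so some step lowers it, and that step exhibits L(b) as a
finite-dimensional quotient. -/
theorem IsStarEnd.finite_smithL [CharZero k] (hu : u + C c ≠ 0) {Z Zs : SubRoots u c}
    (h : IsStarEnd u c Z Zs) {b : k} (hb : b ∈ distinctRoots u c) (h0 : smithPhi u c Z b ≠ 0) :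
    Module.Finite k (SmithL u b) := by
  obtain ⟨h1, h2⟩ := h
  induction h1 using Relation.ReflTransGen.head_induction_on with
  | refl => exact absurd (smithPhi_eq_zero_of_smithEll_eq_zero h2 b) h0
  | head hstep _ ih =>
    obtain ⟨d, n, hA, rfl⟩ := hstep.exists_isAdjacent hu
    by_cases hbd : b = d
    · exact hbd ▸ hA.finite_smithL hu
    · refine ih ?_
      rwa [hA.smithPhi_eq ((mem_distinctRoots b).1 hb), if_neg hbd, add_zero] at h0

open Classical in
/-- The module `A_c(Z)` has a composition series with the expected factors. -/
theorem IsStarEnd.exists_compositionSeries [IsAlgClosed k] [CharZero k] (hu : u + C c ≠ 0)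
    {Z Zs : SubRoots u c} (h : IsStarEnd u c Z Zs) :
    ∃ s : CompositionSeries (Submodule (SmithAlgebra u) (SmithA u c Z)),
      s.head = ⊥ ∧ s.last = ⊤ ∧ factorCount s (SmithA u c Zs) = 1 ∧
      (∀ b ∈ distinctRoots u c, factorCount s (SmithL u b) = smithPhi u c Z b) ∧
      ∀ i : Fin s.length,
        Nonempty (seriesFactor s i ≃ₗ[SmithAlgebra u] SmithA u c Zs) ∨
        ∃ b ∈ distinctRoots u c,
          Nonempty (seriesFactor s i ≃ₗ[SmithAlgebra u] SmithL u b) := by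
  obtain ⟨h1, h2⟩ := h
  induction h1 using Relation.ReflTransGen.head_induction_on with
  | refl =>
    have := SmithA.isSimpleModule hu h2
    obtain ⟨s, hs0, hs1, hlen, hs⟩ :=
      exists_compositionSeries_of_isSimpleModule (S := SmithAlgebra u) (M := SmithA u c Zs)
    refine ⟨s, hs0, hs1, ?_, fun b _ => ?_, fun i => Or.inl (hs i)⟩
    · rw [factorCount, Nat.card_congr (Equiv.subtypeUnivEquiv hs), Nat.card_eq_fintype_card,
        Fintype.card_fin, hlen]
    · rw [smithPhi_eq_zero_of_smithEll_eq_zero h2, factorCount, Nat.card_eq_zero]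
      left
      refine ⟨fun ⟨i, ⟨f⟩⟩ => ?_⟩
      obtain ⟨g⟩ := hs i
      exact (SmithA.isEmpty_equiv_smithL Zs b).false (g.symm.trans f)
  | @head Y Y' hstep _ ih =>
    obtain ⟨b, n, hA, rfl⟩ := hstep.exists_isAdjacent hu
    obtain ⟨e⟩ := hA.nonempty_quotient_equiv hu
    have : IsSimpleModule (SmithAlgebra u) (SmithL u b) := by
      have := isSimpleModule_iff_isCoatom.2 hA.isCoatom_range
      exact IsSimpleModule.congr e.symm
    have : Nontrivial (SmithL u b) := IsSimpleModule.nontrivial (SmithAlgebra u) _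
    obtain ⟨s, hs0, hs1, hcA, hcL, hfac⟩ := ih
    obtain ⟨t, f, ht0, ht1, hsome, hnone⟩ := exists_compositionSeries_extend
      (SmithA.starHom Y hA.mem hA.mem_compl) (SmithA.starHom_injective Y hA.mem hA.mem_compl)
      hA.isCoatom_range s hs0 hs1
    have hnone' : ∀ i, f i = none →
        Nonempty (seriesFactor t i ≃ₗ[SmithAlgebra u] SmithL u b) := fun i hi => by
      obtain ⟨g⟩ := hnone i hi
      exact ⟨g.trans e⟩
    refine ⟨t, ht0, ht1, ?_, fun d hd => ?_, fun i => ?_⟩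
    · rw [factorCount_extend f hsome hnone', hcA, if_neg]
      rintro ⟨g⟩
      exact (SmithA.isEmpty_equiv_smithL Zs b).false g.symm
    · rw [factorCount_extend f hsome hnone', hcL d hd,
        hA.smithPhi_eq ((mem_distinctRoots d).1 hd)]
      congr 1
      -- The new factor L(b) counts for `d` exactly when `d = b`, which is where φ drops.
      refine if_congr ⟨fun ⟨g⟩ => (SmithL.eq_of_equiv g).symm, ?_⟩ rfl rfl
      rintro rfl
      exact ⟨LinearEquiv.refl _ _⟩
    · rcases hi : f i with _ | j
      · exact Or.inr ⟨b, (mem_distinctRoots b).2 hA.mem_roots, hnone' i hi⟩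
      · obtain ⟨g⟩ := hsome i j hi
        rcases hfac j with ⟨⟨g'⟩⟩ | ⟨d, hd, ⟨g'⟩⟩
        · exact Or.inl ⟨g.trans g'⟩
        · exact Or.inr ⟨d, hd, ⟨g.trans g'⟩⟩

theorem mainTheorem1 {k : Type u} [Field k] [IsAlgClosed k] [CharZero k]
    (u : k[X]) (hg : smithG u ≠ 0) (c : k) (Z : SubRoots u c) :
    (∃! Zs : SubRoots u c, IsStarEnd u c Z Zs) ∧
    ∀ Zs : SubRoots u c, IsStarEnd u c Z Zs →
      Nonempty (moduleSocle (SmithAlgebra u) (SmithA u c Z) ≃ₗ[SmithAlgebra u] SmithA u c Zs) ∧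
      K0Class (SmithAlgebra u) (SmithA u c Z) =
        K0Class (SmithAlgebra u) (SmithA u c Zs) +
          ∑ b ∈ distinctRoots u c,
            smithPhi u c Z b • K0Class (SmithAlgebra u) (SmithL u b) ∧
      IsFiniteLength (SmithAlgebra u) (SmithA u c Z) ∧
      (∀ b ∈ distinctRoots u c, smithPhi u c Z b ≠ 0 → Module.Finite k (SmithL u b)) ∧
      ∀ s : CompositionSeries (Submodule (SmithAlgebra u) (SmithA u c Z)),
        s.head = ⊥ → s.last = ⊤ →
          factorCount s (SmithA u c Zs) = 1 ∧
          (∀ b ∈ distinctRoots u c, factorCount s (SmithL u b) = smithPhi u c Z b) ∧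
          ∀ i : Fin s.length,
            Nonempty (seriesFactor s i ≃ₗ[SmithAlgebra u] SmithA u c Zs) ∨
            ∃ b ∈ distinctRoots u c,
              Nonempty (seriesFactor s i ≃ₗ[SmithAlgebra u] SmithL u b) := by
  have hu := add_C_ne_zero_of_smithG_ne_zero hg c
  refine ⟨existsUnique_isStarEnd hu Z, fun Zs h => ⟨h.nonempty_socle_equiv hu, h.K0Class_eq hu,
    ?_, fun b hb h0 => h.finite_smithL hu hb h0, fun s hs0 hs1 => ?_⟩⟩
  · obtain ⟨t, ht0, ht1, -⟩ := h.exists_compositionSeries hu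
    exact isFiniteLength_iff_exists_compositionSeries.2 ⟨t, ht0, ht1⟩
  · obtain ⟨t, ht0, ht1, hcA, hcL, hfac⟩ := h.exists_compositionSeries hu
    have hst : CompositionSeries.Equivalent s t :=
      CompositionSeries.jordan_holder s t (hs0.trans ht0.symm) (hs1.trans ht1.symm)
    refine ⟨?_, fun b hb => ?_, ?_⟩
    · rw [factorCount_eq_of_equivalent hst, hcA]
    · rw [factorCount_eq_of_equivalent hst, hcL b hb]
    · obtain ⟨f, hf⟩ := hst
      intro i
      have g : seriesFactor s i ≃ₗ[SmithAlgebra u] seriesFactor t (f i) :=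
        JordanHolderLattice.Iso.linearEquiv (hf i)
      rcases hfac (f i) with ⟨⟨g'⟩⟩ | ⟨d, hd, ⟨g'⟩⟩
      · exact Or.inl ⟨g.trans g'⟩
      · exact Or.inr ⟨d, hd, ⟨g.trans g'⟩⟩

end Main
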